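/- **Theorem 3.1.** Fix $\alpha\in\mathbb C$. For a collection $Y=\{Y_j\}_{j=1}^{N}$ of $N$ distinct points in $\mathbb R^3$, let $H_Y$ be the Schrödinger Hamiltonian in $L^2(\mathbb R^3)$ with point interactions of strength parameter $\alpha$ at the centres $Y_j$. Its multiset of resonances $\Sigma(H_Y)$ is, by definition, the multiset of zeros (with multiplicities) of the entire function $z\mapsto\det\Gamma_Y(z)$, where $$\Gamma_Y(z)=\Big[\big(\alpha-\tfrac{iz}{4\pi}\big)\delta_{jj'}-\widetilde G_z(Y_j-Y_{j'})\Big]_{j,j'=1}^{N},\qquad \widetilde G_z(x)=\frac{e^{iz|x|}}{4\pi|x|}\ \ (x\neq0),\quad \widetilde G_z(0)=0 .$$ Let $N_{H_Y}(R)$ be the number of resonances $k\in\Sigma(H_Y)$ with $|k|\le R$, counted with multiplicities; let $\mathrm{Ad}(H_Y)=\lim_{R\to\infty}N_{H_Y}(R)/R$ be the total asymptotic density of resonances; and let $$V(Y)=\max_{\sigma\in S_N}\sum_{j=1}^{N}|Y_j-Y_{\sigma(j)}|$$ be the size of $Y$. Let $m\in\mathbb N$, $r>0$, and let $\Upsilon=\{\Upsilon_j\}_{j=1}^m$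 be a uniform binomial process of sample size $m$ in the ball $\mathbb B_r=\{x\in\mathbb R^3:|x|<r\}$, i.e. $\Upsilon_1,\dots,\Upsilon_m$ are independent random points, each uniformly distributed in $\mathbb B_r$. Then almost surely the points $\Upsilon_j$ are distinct (so that $H_\Upsilon$ is defined), the limit $\mathrm{Ad}(H_\Upsilon)$ exists, and $$\mathrm{Ad}(H_\Upsilon)=\frac{V(\Upsilon)}{\pi}.$$ -/

import Mathlib

open MeasureTheory ProbabilityTheory Filter Topology
open scoped ENNReal

noncomputable section

/-- Physical space `ℝ³` with its Euclidean norm. -/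
abbrev Space3 : Type := EuclideanSpace ℝ (Fin 3)

namespace PointInteraction

/-- The integral kernel `G_z(x) = e^{iz|x|} / (4π|x|)` of the free resolvent `(-Δ - z²)⁻¹`, modified
to take the value `0` at `x = 0`. -/
def greenTilde (z : ℂ) (x : Space3) : ℂ :=
  if x = 0 then 0
  else Complex.exp (Complex.I * z * (‖x‖ : ℂ)) / (4 * (Real.pi : ℂ) * (‖x‖ : ℂ))

/-- The matrix `Γ_Y(z)` in the Krein-type formula for the resolvent of the Hamiltonian `H_Y` with
point interactions of strength parameter `α` at the centres `Y_j`. -/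
def gammaMatrix {N : ℕ} (α : ℂ) (Y : Fin N → Space3) (z : ℂ) : Matrix (Fin N) (Fin N) ℂ :=
  Matrix.of fun j j' =>
    (if j = j' then α - Complex.I * z / (4 * (Real.pi : ℂ)) else 0) - greenTilde z (Y j - Y j')

/-- The characteristic determinant `det Γ_Y`. -/
def charDet {N : ℕ} (α : ℂ) (Y : Fin N → Space3) (z : ℂ) : ℂ :=
  (gammaMatrix α Y z).det

/-- The multiplicity of `k` in the multiset `Σ(H_Y)` of resonances of `H_Y`, which is by definition
the multiset of zeros of the entire function `det Γ_Y`: the order of vanishing of `det Γ_Y` at `k`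
(it is `0` exactly when `k` is not a resonance). -/
def resonanceMult {N : ℕ} (α : ℂ) (Y : Fin N → Space3) (k : ℂ) : ℕ∞ :=
  analyticOrderAt (charDet α Y) k

/-- The counting function `N(R) = #{k ∈ Σ(H_Y) : |k| ≤ R}`, resonances being counted with their
multiplicities, as an element of `[0, ∞]`. -/
def resonanceCount {N : ℕ} (α : ℂ) (Y : Fin N → Space3) (R : ℝ) : ℝ≥0∞ :=
  ∑' k : {k : ℂ // ‖k‖ ≤ R}, ((resonanceMult α Y k : ℕ∞) : ℝ≥0∞)

/-- `Ad(H_Y) = d`: the limit `lim_{R → ∞} N(R) / R` exists in `[0, ∞]` and equals the real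
number `d ≥ 0`. -/
def HasTotalAsymptoticDensity {N : ℕ} (α : ℂ) (Y : Fin N → Space3) (d : ℝ) : Prop :=
  0 ≤ d ∧ Tendsto (fun R : ℝ => resonanceCount α Y R / ENNReal.ofReal R) atTop
    (𝓝 (ENNReal.ofReal d))

/-- The size `V(Y) = max_σ ∑_j |Y_j - Y_{σ(j)}|` of a finite collection of points. -/
def size {N : ℕ} (Y : Fin N → Space3) : ℝ :=
  Finset.univ.sup' Finset.univ_nonempty
    fun σ : Equiv.Perm (Fin N) => ∑ j, ‖Y j - Y (σ j)‖

/-- The class `Θ(m, 𝔹_r)`: `Υ = {Υ_j}_{j=1}^m` with independent random points `Υ_j`, each of them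
uniformly distributed in the ball `𝔹_r` of radius `r` centred at the origin of `ℝ³`. -/
structure IsUniformBinomialProcess {Ω : Type*} [MeasurableSpace Ω] (P : Measure Ω) (m : ℕ) (r : ℝ)
    (Υ : Fin m → Ω → Space3) : Prop where
  aemeasurable : ∀ j, AEMeasurable (Υ j) P
  indep : iIndepFun Υ P
  uniform : ∀ j, pdf.IsUniform (Υ j) (Metric.ball (0 : Space3) r) P volume

end PointInteraction

end

/-!
For distinct centres the Leibniz expansion writes `det Γ_Y(z)` as an exponential polynomial
`∑_σ s_σ (α - iz/4π)^{p_σ} e^{i z L_σ}`, with one term for each permutation `σ`: here `p_σ` is the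
number of fixed points of `σ` and `L_σ = ∑ |Y_{σ(j)} - Y_j|`, so that the frequencies run from
`0` (attained by the identity only) to the size `V = V(Y)`.

*Counting zeros.* If the terms of maximal frequency do not cancel, then
`log |f(z)| = V (Im z)⁻ + o(|z|)` for `f = det Γ_Y`, as an upper bound everywhere and as a lower
bound outside small angles around the real axis. The Poisson inequality for `log |f|`
(`AnalyticOnNhd.log_norm_le_circleAverage_poissonKernel`) shows that the exceptional arcs carry only
a small part of the circle average, so the average of `log |f|` over `|z| = R` is asymptotic to
`V R / π` (`tendsto_circleAverage_log_norm_div`). Jensen's formula identifies its increments with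
those of `∫ n(t) dt / t`, and a Tauberian argument gives `n(R) ~ V R / π`
(`tendsto_tsum_analyticOrderAt_div`, `expPoly_tendsto_zeroCount_div`).

*Genericity.* Almost surely two permutations have the same length `L` only if they have the same
undirected edges (`PointInteraction.ae_edgeCount_eq_of_permLength_eq`): otherwise a nontrivial
integer combination of the distances `|Y_i - Y_j|` vanishes, and as a function of a single point such
a combination has null level sets (`measure_sum_mul_dist_eq_const`), because its restrictions to rays
from one of the other points are analytic and not constant. Permutations with the same undirected
edges differ by reversing some of their cycles, so they have the same sign and the same product of
matrix entries (`sign_eq_of_edgeCount_eq`, `prod_eq_of_edgeCount_eq`). Hence the terms of maximal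
frequency are all equal and do not cancel.
-/

/-! ### The Poisson inequality for `log ‖f‖` -/

section PoissonInequality

open Metric Real MeromorphicOn

variable {R : ℝ} {w : ℂ}

lemma continuousOn_poissonKernel_sphere (hw : w ∈ ball (0 : ℂ) R) :
    ContinuousOn (poissonKernel 0 w) (sphere 0 |R|) := by
  rw [poissonKernel_eq_re_herglotzRieszKernel]
  exact Complex.continuous_re.comp_continuousOn (continuousOn_herglotzRieszKernel_sphere hw)

lemma CircleIntegrable.poissonKernel_mul {φ : ℂ → ℝ} (hφ : CircleIntegrable φ 0 R)
    (hw : w ∈ ball (0 : ℂ) R) :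
    CircleIntegrable (fun z => poissonKernel 0 w z * φ z) 0 R :=
  hφ.continuousOn_smul (continuousOn_poissonKernel_sphere hw)

lemma poissonKernel_nonneg_of_mem_sphere {z : ℂ} (hw : w ∈ ball (0 : ℂ) R)
    (hz : z ∈ sphere (0 : ℂ) |R|) : 0 ≤ poissonKernel 0 w z := by
  have hR : 0 < R := pos_of_mem_ball hw
  rw [poissonKernel_def]
  simp only [mem_ball, dist_zero_right, mem_sphere, abs_of_pos hR] at hw hz
  simp only [sub_zero]
  have : ‖w‖ ^ 2 ≤ ‖z‖ ^ 2 := by rw [hz]; gcongr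
  exact div_nonneg (by linarith) (by positivity)

lemma circleAverage_poissonKernel_mul_const (hw : w ∈ ball (0 : ℂ) R) (a : ℝ) :
    circleAverage (fun z => poissonKernel 0 w z * a) 0 R = a := by
  have h : InnerProductSpace.HarmonicOnNhd (fun _ : ℂ => a) (closedBall 0 R) :=
    fun x _ => InnerProductSpace.harmonicAt_const a
  exact h.circleAverage_poissonKernel_smul hw

/-- The reflection of `ρ` in the circle `|z| = R` is at least as far from `w` as `ρ` itself,
after rescaling by `|ρ| / R`. -/
lemma norm_sub_le_norm_reflection {ρ : ℂ} (hw : w ∈ ball (0 : ℂ) R)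
    (hρ : ρ ∈ closedBall (0 : ℂ) R) :
    ‖w - ρ‖ ≤ ‖(R : ℂ) - (starRingEnd ℂ) ρ * w / R‖ := by
  have hR : 0 < R := pos_of_mem_ball hw
  simp only [mem_ball, mem_closedBall, dist_zero_right] at hw hρ
  have h1 : (R : ℂ) - (starRingEnd ℂ) ρ * w / R = ((R : ℂ) ^ 2 - (starRingEnd ℂ) ρ * w) / R := by
    have : (R : ℂ) ≠ 0 := by exact_mod_cast hR.ne'
    field_simp
  rw [h1, norm_div, Complex.norm_real, norm_of_nonneg hR.le, le_div_iff₀ hR]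
  apply le_of_sq_le_sq _ (norm_nonneg _)
  rw [mul_pow, ← Complex.normSq_eq_norm_sq, ← Complex.normSq_eq_norm_sq]
  have hw2 : Complex.normSq w ≤ R ^ 2 := by
    rw [Complex.normSq_eq_norm_sq]; gcongr
  have hρ2 : Complex.normSq ρ ≤ R ^ 2 := by
    rw [Complex.normSq_eq_norm_sq]; gcongr
  rw [Complex.normSq_apply] at *
  simp only [Complex.normSq_apply, Complex.sub_re, Complex.sub_im, Complex.mul_re, Complex.mul_im,
    Complex.conj_re, Complex.conj_im, ← Complex.ofReal_pow, Complex.ofReal_re, Complex.ofReal_im]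
    at *
  nlinarith [mul_nonneg (sub_nonneg.2 hw2) (sub_nonneg.2 hρ2)]

lemma log_norm_sub_le_circleAverage_poissonKernel {ρ : ℂ} (hw : w ∈ ball (0 : ℂ) R)
    (hρ : ρ ∈ closedBall (0 : ℂ) R) (hwρ : w ≠ ρ) :
    log ‖w - ρ‖ ≤ circleAverage (fun z => poissonKernel 0 w z * log ‖z - ρ‖) 0 R := by
  have hR : 0 < R := pos_of_mem_ball hw
  have hRc : (R : ℂ) ≠ 0 := by exact_mod_cast hR.ne'
  by_cases hρs : ρ ∈ sphere (0 : ℂ) R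
  · have := circleAverage_re_herglotzRieszKernel_mul_log hρs hw
    rw [← poissonKernel_eq_re_herglotzRieszKernel] at this
    exact this.ge
  have hρb : ρ ∈ ball (0 : ℂ) R := by
    simp only [mem_ball, mem_closedBall, mem_sphere] at *
    exact lt_of_le_of_ne hρ hρs
  -- on the circle, `|z - ρ|` is the modulus of a function without zeros in the disc
  have h1 : circleAverage (fun z => poissonKernel 0 w z * log ‖z - ρ‖) 0 R =
      circleAverage (poissonKernel 0 w • fun z => log ‖(R : ℂ) - (starRingEnd ℂ) ρ * z / R‖) 0 R := by
    apply circleAverage_congr_sphere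
    intro z hz
    rw [abs_of_pos hR] at hz
    have h2 := Complex.norm_canonicalFactor_eval_circle_eq_one hρb hz
    have hzρ : z - ρ ≠ 0 := by
      intro h
      rw [sub_eq_zero] at h
      exact hρs (h ▸ hz)
    have h3 : (R : ℂ) - (starRingEnd ℂ) ρ * z / R = Complex.canonicalFactor R ρ z * (z - ρ) := by
      rw [Complex.canonicalFactor_apply]
      field_simp
    simp [h3, h2]
  rw [h1, InnerProductSpace.HarmonicOnNhd.circleAverage_poissonKernel_smul _ hw]
  · have : w - ρ ≠ 0 := sub_ne_zero.2 hwρ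
    exact log_le_log (by positivity) (norm_sub_le_norm_reflection hw hρ)
  · intro z hz
    apply AnalyticAt.harmonicAt_log_norm
    · fun_prop
    · intro h
      have h2 : (R : ℂ) * R = (starRingEnd ℂ) ρ * z := by
        field_simp at h
        linear_combination h
      have h3 : R * R = ‖ρ‖ * ‖z‖ := by
        have := congrArg norm h2
        simpa [abs_of_pos hR] using this
      simp only [mem_ball, mem_closedBall, dist_zero_right] at hρb hz
      nlinarith [norm_nonneg ρ, norm_nonneg z]

/-- **Poisson inequality**: the logarithm of the modulus of an analytic function is at most the
Poisson integral of its boundary values. -/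
theorem AnalyticOnNhd.log_norm_le_circleAverage_poissonKernel {f : ℂ → ℂ}
    (hf : AnalyticOnNhd ℂ f (closedBall 0 R)) (hw : w ∈ ball (0 : ℂ) R) (hfw : f w ≠ 0) :
    Real.log ‖f w‖ ≤ circleAverage (fun z => poissonKernel 0 w z * Real.log ‖f z‖) 0 R := by
  have hR : 0 < R := pos_of_mem_ball hw
  have hwc : w ∈ closedBall (0 : ℂ) R := ball_subset_closedBall hw
  have hmer := hf.meromorphicOn
  have hord : ∀ u : closedBall (0 : ℂ) R, meromorphicOrderAt f u ≠ ⊤ := by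
    rw [← hmer.exists_meromorphicOrderAt_ne_top_iff_forall
      ⟨nonempty_closedBall.mpr hR.le, (convex_closedBall 0 R).isPreconnected⟩]
    refine ⟨⟨w, hwc⟩, ?_⟩
    rw [(hf w hwc).meromorphicOrderAt_eq, (hf w hwc).analyticOrderAt_eq_zero.2 hfw]
    simp
  have hfin := (divisor f (closedBall 0 R)).finiteSupport (isCompact_closedBall 0 R)
  obtain ⟨g, h₁g, h₂g, h₃g⟩ := hmer.extract_zeros_poles hord hfin
  have hacc : AccPt w (𝓟 (closedBall 0 R)) := by
    apply accPt_iff_frequently_nhdsNE.mpr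
    apply compl_notMem
    apply mem_nhdsWithin.mpr
    use ball 0 R
    simpa [hR, isOpen_ball] using ⟨by simpa using hw, fun z hz => ball_subset_closedBall hz.1⟩
  have hlog := extract_zeros_poles_log h₂g h₃g
  have hw_eq := MeromorphicOn.log_norm_meromorphicTrailingCoeffAt_extract_zeros_poles hfin hwc hacc
    (hmer w hwc) (h₁g w hwc) (h₂g ⟨w, hwc⟩) h₃g
  rw [(hf w hwc).meromorphicTrailingCoeffAt_of_ne_zero hfw] at hw_eq
  set D := divisor f (closedBall 0 R) with hD
  have hsum : ∀ x : ℂ, ∑ᶠ u, (D u : ℝ) * Real.log ‖x - u‖ =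
      ∑ u ∈ hfin.toFinset, (D u : ℝ) * Real.log ‖x - u‖ := by
    intro x
    apply finsum_eq_sum_of_support_subset
    intro u
    contrapose
    aesop
  have hsumfun : (∑ᶠ u, ((D u : ℝ) * Real.log ‖· - u‖) : ℂ → ℝ) =
      fun x => ∑ u ∈ hfin.toFinset, (D u : ℝ) * Real.log ‖x - u‖ := by
    rw [finsum_eq_sum_of_support_subset (s := hfin.toFinset)]
    · ext x
      simp
    · intro u
      contrapose
      aesop
  have hDnonneg : ∀ u, 0 ≤ D u := fun u => (hf.divisor_nonneg) u
  have hint : ∀ u : ℂ, CircleIntegrable (fun z => Real.log ‖z - u‖) 0 R := fun u =>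
    circleIntegrable_log_norm_sub_const R
  have hDw : ∀ u ∈ hfin.toFinset, w ≠ u := by
    rintro u hu rfl
    have hu' : D w ≠ 0 := by simpa using hu
    apply hu'
    rw [hD, hf.divisor_apply hwc, (hf w hwc).analyticOrderAt_eq_zero.2 hfw]
    simp
  have hDb : ∀ u ∈ hfin.toFinset, u ∈ closedBall (0 : ℂ) R := by
    intro u hu
    exact D.supportWithinDomain (by simpa using hu)
  have hsph : sphere (0 : ℂ) |R| ⊆ closedBall 0 R := by
    rw [abs_of_pos hR]; exact sphere_subset_closedBall
  have hgint : CircleIntegrable (fun z => Real.log ‖g z‖) 0 R :=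
    (h₁g.mono hsph).meromorphicOn.circleIntegrable_log_norm
  calc Real.log ‖f w‖ = ∑ u ∈ hfin.toFinset, (D u : ℝ) * Real.log ‖w - u‖ + Real.log ‖g w‖ := by
        rw [hw_eq, hsum]
    _ ≤ ∑ u ∈ hfin.toFinset,
          (D u : ℝ) * circleAverage (fun z => poissonKernel 0 w z * Real.log ‖z - u‖) 0 R +
        circleAverage (fun z => poissonKernel 0 w z * Real.log ‖g z‖) 0 R := by
        gcongr with u hu
        · exact_mod_cast hDnonneg u
        · exact log_norm_sub_le_circleAverage_poissonKernel hw (hDb u hu) (hDw u hu)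
        · refine (InnerProductSpace.HarmonicOnNhd.circleAverage_poissonKernel_smul
            (f := fun z => Real.log ‖g z‖) ?_ hw).ge
          exact fun x hx => (h₁g x hx).harmonicAt_log_norm (h₂g ⟨x, hx⟩)
    _ = circleAverage (fun z => poissonKernel 0 w z * Real.log ‖f z‖) 0 R := by
        have h1 : circleAverage (fun z => poissonKernel 0 w z * Real.log ‖f z‖) 0 R =
            circleAverage (fun z => (∑ u ∈ hfin.toFinset,
              (D u : ℝ) • (poissonKernel 0 w z * Real.log ‖z - u‖)) +
                poissonKernel 0 w z * Real.log ‖g z‖) 0 R := by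
          apply circleAverage_congr_codiscreteWithin _ hR.ne'
          filter_upwards [codiscreteWithin_mono hsph hlog] with z hz
          rw [hz, hsumfun]
          simp only [Pi.add_apply, mul_add, Finset.mul_sum, smul_eq_mul]
          congr 1
          exact Finset.sum_congr rfl fun u _ => by ring
        rw [h1, circleAverage_fun_add _ (hgint.poissonKernel_mul hw), circleAverage_fun_sum]
        · congr 1
          exact Finset.sum_congr rfl fun u _ => by rw [circleAverage_fun_smul, smul_eq_mul]
        · exact fun u _ => ((hint u).poissonKernel_mul hw).const_smul
        · exact CircleIntegrable.fun_sum _ fun u _ => ((hint u).poissonKernel_mul hw).const_smul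

end PoissonInequality

/-! ### Circle averages of `log ‖f‖` for functions of completely regular growth -/

section RegularGrowth

open Metric Real

lemma integral_max_neg_sin : ∫ θ in (0 : ℝ)..2 * π, max (-sin θ) 0 = 2 := by
  have hc : Continuous fun θ : ℝ => max (-sin θ) 0 := by fun_prop
  rw [← intervalIntegral.integral_add_adjacent_intervals (b := π) (hc.intervalIntegrable _ _)
    (hc.intervalIntegrable _ _)]
  have h1 : ∫ θ in (0 : ℝ)..π, max (-sin θ) 0 = ∫ θ in (0 : ℝ)..π, 0 := by
    apply intervalIntegral.integral_congr
    intro θ hθ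
    rw [Set.uIcc_of_le pi_pos.le] at hθ
    exact max_eq_right (by linarith [sin_nonneg_of_mem_Icc hθ])
  have h2 : ∫ θ in π..2 * π, max (-sin θ) 0 = ∫ θ in π..2 * π, -sin θ := by
    apply intervalIntegral.integral_congr
    intro θ hθ
    rw [Set.uIcc_of_le (by linarith [pi_pos])] at hθ
    have : 0 ≤ sin (θ - π) :=
      sin_nonneg_of_mem_Icc ⟨by linarith [hθ.1], by linarith [hθ.2]⟩
    rw [sin_sub_pi] at this
    exact max_eq_left this
  rw [h1, h2]
  simp
  norm_num

lemma circleAverage_max_neg_im {R : ℝ} (hR : 0 ≤ R) :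
    circleAverage (fun z : ℂ => max (-z.im) 0) 0 R = R / π := by
  have h : ∀ θ : ℝ, max (-(circleMap 0 R θ).im) 0 = R * max (-sin θ) 0 := by
    intro θ
    rw [circleMap_zero, Complex.im_ofReal_mul, Complex.exp_ofReal_mul_I_im,
      mul_max_of_nonneg _ _ hR]
    simp
  rw [circleAverage_def]
  simp only [h]
  rw [intervalIntegral.integral_const_mul, integral_max_neg_sin, smul_eq_mul]
  field_simp

/-- On the part of the circle `|z| = R` inside the strip `|Im z| < ε R` and in the half-plane
`s Re z ≥ 0`, the Poisson kernel with pole `R (s (1 - ε) + i ε)` is at least `1 / (5 ε)`. -/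
lemma one_le_mul_poissonKernel {R ε s : ℝ} {z : ℂ} (hR : 0 < R) (hε : 0 < ε) (hε' : ε ≤ 1 / 2)
    (hs : s = 1 ∨ s = -1) (hz : ‖z‖ = R) (him : |z.im| < ε * R) (hre : 0 ≤ s * z.re) :
    1 ≤ 5 * ε * poissonKernel 0 (R * (⟨s * (1 - ε), ε⟩ : ℂ)) z := by
  set w : ℂ := R * (⟨s * (1 - ε), ε⟩ : ℂ) with hw
  have hwre : w.re = R * (s * (1 - ε)) := by simp [hw]
  have hwim : w.im = R * ε := by simp [hw]
  have hs2 : s ^ 2 = 1 := by rcases hs with h | h <;> simp [h]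
  have hzsq : z.re ^ 2 + z.im ^ 2 = R ^ 2 := by
    rw [← hz, ← Complex.normSq_eq_norm_sq, Complex.normSq_apply]; ring
  obtain ⟨hi1, hi2⟩ := abs_lt.1 him
  -- `R (1 - ε) ≤ s Re z ≤ R`
  have hx2 : s * z.re ≤ R := by
    apply le_of_sq_le_sq _ hR.le
    nlinarith [sq_nonneg z.im]
  have hx1 : R * (1 - ε) ≤ s * z.re := by
    apply le_of_sq_le_sq _ hre
    have h1 : (s * z.re) ^ 2 = R ^ 2 - z.im ^ 2 := by rw [mul_pow, hs2]; linarith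
    have h2 : z.im ^ 2 ≤ (ε * R) ^ 2 := by
      rw [sq_le_sq, abs_of_pos (mul_pos hε hR)]; exact him.le
    rw [h1]
    nlinarith [mul_pos hε hR, sq_nonneg (ε * R), mul_pos hR hR, mul_pos hε (mul_pos hR hR)]
  have hden : ‖z - w‖ ^ 2 ≤ 5 * (ε * R) ^ 2 := by
    rw [← Complex.normSq_eq_norm_sq, Complex.normSq_apply, Complex.sub_re, Complex.sub_im, hwre,
      hwim]
    have h1 : (z.re - R * (s * (1 - ε))) * (z.re - R * (s * (1 - ε))) =
        (s * z.re - R * (1 - ε)) ^ 2 := by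
      have : (s * z.re - R * (1 - ε)) ^ 2 = s ^ 2 * (z.re - R * (s * (1 - ε))) ^ 2 +
        (1 - s ^ 2) * (-2 * s * z.re * R * (1 - ε) + R ^ 2 * (1 - ε) ^ 2 * (1 + s ^ 2)) := by ring
      rw [this, hs2]; ring
    have h2 : (s * z.re - R * (1 - ε)) ^ 2 ≤ (ε * R) ^ 2 := by
      apply pow_le_pow_left₀ (by linarith); nlinarith
    have h3 : (z.im - R * ε) * (z.im - R * ε) ≤ (2 * (ε * R)) ^ 2 := by
      rw [← sq, sq_le_sq, abs_of_pos (by positivity : 0 < 2 * (ε * R)), abs_le]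
      constructor <;> nlinarith
    rw [h1]
    nlinarith
  have hnum : ε * R ^ 2 ≤ ‖z‖ ^ 2 - ‖w‖ ^ 2 := by
    rw [hz, ← Complex.normSq_eq_norm_sq, Complex.normSq_apply, hwre, hwim]
    have : R * (s * (1 - ε)) * (R * (s * (1 - ε))) = s ^ 2 * (R ^ 2 * (1 - ε) ^ 2) := by ring
    rw [this, hs2]
    nlinarith [mul_pos hε (mul_pos hR hR)]
  have hne : 0 < ‖z - w‖ ^ 2 := by
    have : z ≠ w := by
      rintro rfl
      have := mul_pos hε (mul_pos hR hR)
      nlinarith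
    have : z - w ≠ 0 := sub_ne_zero.2 this
    positivity
  rw [poissonKernel_def]
  simp only [sub_zero]
  rw [← mul_div_assoc, le_div_iff₀ hne]
  nlinarith

/-- The pole of the Poisson kernels used near the real points `± R` of the circle. -/
lemma norm_ofReal_mul_mk_bounds {R ε s : ℝ} (hR : 0 < R) (hε : 0 < ε) (hε' : ε ≤ 1 / 2)
    (hs : s = 1 ∨ s = -1) :
    ‖(R : ℂ) * (⟨s * (1 - ε), ε⟩ : ℂ)‖ < R ∧ R / 2 ≤ ‖(R : ℂ) * (⟨s * (1 - ε), ε⟩ : ℂ)‖ := by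
  have hs2 : s ^ 2 = 1 := by rcases hs with h | h <;> simp [h]
  have h1 : ‖(R : ℂ) * (⟨s * (1 - ε), ε⟩ : ℂ)‖ ^ 2 = R ^ 2 * (1 - 2 * ε + 2 * ε ^ 2) := by
    rw [norm_mul, mul_pow, Complex.norm_real, ← Complex.normSq_eq_norm_sq, Complex.normSq_apply,
      norm_eq_abs, sq_abs]
    have : s * (1 - ε) * (s * (1 - ε)) = s ^ 2 * (1 - ε) ^ 2 := by ring
    simp only [this, hs2]
    ring
  constructor
  · apply lt_of_pow_lt_pow_left₀ 2 hR.le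
    rw [h1]
    have : 1 - 2 * ε + 2 * ε ^ 2 < 1 := by nlinarith
    nlinarith [mul_pos hR hR]
  · apply le_of_sq_le_sq _ (norm_nonneg _)
    rw [h1]
    have : 1 / 4 ≤ 1 - 2 * ε + 2 * ε ^ 2 := by nlinarith [sq_nonneg (2 * ε - 1)]
    nlinarith [mul_pos hR hR]

/-- The lower bound on `log ‖f‖` away from the real axis controls the circle average near the real
axis as well, because the defect `h = V (Im z)⁻ + ε R - log ‖f‖ ≥ 0` has a Poisson integral
`O(R)` at points at distance about `ε R` from `± R`, where the Poisson kernel is of size `1 / ε`. -/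
lemma abs_circleAverage_log_norm_sub_le {f : ℂ → ℂ} (hf : AnalyticOnNhd ℂ f Set.univ) {V : ℝ}
    (hV : 0 ≤ V) {ε R : ℝ} (hε : 0 < ε) (hε' : ε ≤ 1 / 2) (hR : 0 < R)
    (hupper : ∀ z : ℂ, ‖z‖ = R → ‖f z‖ ≤ exp (V * max (-z.im) 0 + ε * R))
    (hlower : ∀ z : ℂ, R / 2 ≤ ‖z‖ → ‖z‖ ≤ R → ε * ‖z‖ ≤ |z.im| →
      exp (V * max (-z.im) 0 - ε * ‖z‖) ≤ ‖f z‖) :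
    |circleAverage (fun z => log ‖f z‖) 0 R - V * R / π| ≤ (10 * V + 23) * ε * R := by
  set u : ℂ → ℝ := fun z => V * max (-z.im) 0 + ε * R with hu
  set h : ℂ → ℝ := fun z => u z - log ‖f z‖ with hh
  have huc : Continuous u := by
    have := Complex.continuous_im
    fun_prop
  have hfint : CircleIntegrable (fun z => log ‖f z‖) 0 R :=
    (hf.mono (Set.subset_univ _)).meromorphicOn.circleIntegrable_log_norm
  have huint : CircleIntegrable u 0 R := huc.continuousOn.circleIntegrable'
  have hhint : CircleIntegrable h 0 R := huint.sub hfint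
  have hu0 : ∀ z, 0 ≤ u z := fun z => by
    simp only [hu]; positivity
  have hsph : ∀ z ∈ sphere (0 : ℂ) |R|, ‖z‖ = R := by
    intro z hz; simpa [abs_of_pos hR] using hz
  have hh0 : ∀ z ∈ sphere (0 : ℂ) |R|, 0 ≤ h z := by
    intro z hz
    by_cases hfz : f z = 0
    -- here `log 0 = 0`
    · simpa [hh, hfz] using hu0 z
    · have := log_le_log (norm_pos_iff.2 hfz) (hupper z (hsph z hz))
      rw [log_exp] at this
      simp only [hh, hu]; linarith
  have huavg : circleAverage u 0 R = V * R / π + ε * R := by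
    have hc : CircleIntegrable (fun z : ℂ => V • max (-z.im) 0) 0 R := by
      apply Continuous.continuousOn _ |>.circleIntegrable'
      have := Complex.continuous_im
      fun_prop
    have hc' : CircleIntegrable (fun _ : ℂ => ε * R) 0 R :=
      continuous_const.continuousOn.circleIntegrable'
    have := circleAverage_fun_add hc hc'
    rw [circleAverage_fun_smul, circleAverage_max_neg_im hR.le, circleAverage_const] at this
    simp only [smul_eq_mul] at this
    rw [hu, this]; ring
  have havg : circleAverage (fun z => log ‖f z‖) 0 R =
      V * R / π + ε * R - circleAverage h 0 R := by
    rw [hh, circleAverage_fun_sub huint hfint, huavg]; ring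
  -- the poles of the two Poisson kernels
  set w : ℝ → ℂ := fun s => R * (⟨s * (1 - ε), ε⟩ : ℂ) with hw
  have hwb : ∀ s : ℝ, (s = 1 ∨ s = -1) → w s ∈ ball (0 : ℂ) R := fun s hs =>
    mem_ball_zero_iff.2 (norm_ofReal_mul_mk_bounds hR hε hε' hs).1
  have hPavg : ∀ s : ℝ, (s = 1 ∨ s = -1) →
      circleAverage (fun z => poissonKernel 0 (w s) z * h z) 0 R ≤ (V + 2 * ε) * R := by
    intro s hs
    obtain ⟨hb1, hb2⟩ := norm_ofReal_mul_mk_bounds hR hε hε' hs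
    have hwim : (w s).im = R * ε := by simp [hw]
    have hlow := hlower (w s) hb2 hb1.le (by
      rw [hwim, abs_of_pos (mul_pos hR hε), mul_comm R]
      exact mul_le_mul_of_nonneg_left hb1.le hε.le)
    have hlow' : -(ε * R) ≤ log ‖f (w s)‖ := by
      have h1 := log_le_log (exp_pos _) hlow
      rw [log_exp] at h1
      have h2 : 0 ≤ V * max (-(w s).im) 0 := by positivity
      have h3 : ε * ‖w s‖ ≤ ε * R := mul_le_mul_of_nonneg_left hb1.le hε.le
      linarith
    have hfw : f (w s) ≠ 0 := norm_pos_iff.1 ((exp_pos _).trans_le hlow)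
    have hP := (hf.mono (Set.subset_univ _)).log_norm_le_circleAverage_poissonKernel
      (hwb s hs) hfw
    have hPu : circleAverage (fun z => poissonKernel 0 (w s) z * u z) 0 R ≤ (V + ε) * R := by
      have hc' : CircleIntegrable (fun _ : ℂ => (V + ε) * R) 0 R :=
        continuous_const.continuousOn.circleIntegrable'
      refine (circleAverage_mono (huint.poissonKernel_mul (hwb s hs))
        (hc'.poissonKernel_mul (hwb s hs)) ?_).trans_eq
        (circleAverage_poissonKernel_mul_const (hwb s hs) _)
      intro z hz
      apply mul_le_mul_of_nonneg_left _ (poissonKernel_nonneg_of_mem_sphere (hwb s hs) hz)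
      have hmax : max (-z.im) 0 ≤ R := by
        rw [← hsph z hz]
        exact max_le ((neg_le_abs _).trans (Complex.abs_im_le_norm z)) (norm_nonneg _)
      simp only [hu]
      nlinarith
    have hsub : circleAverage (fun z => poissonKernel 0 (w s) z * h z) 0 R =
        circleAverage (fun z => poissonKernel 0 (w s) z * u z) 0 R -
        circleAverage (fun z => poissonKernel 0 (w s) z * log ‖f z‖) 0 R := by
      rw [← circleAverage_fun_sub (huint.poissonKernel_mul (hwb s hs))
        (hfint.poissonKernel_mul (hwb s hs))]
      simp only [hh, mul_sub]
    rw [hsub]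
    linarith
  have hpt : ∀ z ∈ sphere (0 : ℂ) |R|, h z ≤ 2 * ε * R +
      ((5 * ε) • (poissonKernel 0 (w 1) z * h z) + (5 * ε) • (poissonKernel 0 (w (-1)) z * h z)) := by
    intro z hz
    have h0 := hh0 z hz
    have hp1 := mul_nonneg (poissonKernel_nonneg_of_mem_sphere (hwb 1 (Or.inl rfl)) hz) h0
    have hp2 := mul_nonneg (poissonKernel_nonneg_of_mem_sphere (hwb (-1) (Or.inr rfl)) hz) h0
    have hzR := hsph z hz
    simp only [smul_eq_mul]
    have hεR := mul_pos hε hR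
    by_cases him : |z.im| < ε * R
    · rcases le_total 0 z.re with hre | hre
      · have := one_le_mul_poissonKernel hR hε hε' (Or.inl rfl) hzR him (s := 1) (by linarith)
        have h1 := mul_le_mul_of_nonneg_right this h0
        have h2 : 0 ≤ 5 * ε * (poissonKernel 0 (w (-1)) z * h z) := by positivity
        simp only [hw] at *
        linarith
      · have := one_le_mul_poissonKernel hR hε hε' (Or.inr rfl) hzR him (s := -1) (by linarith)
        have h1 := mul_le_mul_of_nonneg_right this h0
        have h2 : 0 ≤ 5 * ε * (poissonKernel 0 (w 1) z * h z) := by positivity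
        simp only [hw] at *
        linarith
    · have hlow := hlower z (by linarith) hzR.le (by rw [hzR]; exact not_lt.1 him)
      have h1 := log_le_log (exp_pos _) hlow
      rw [log_exp, hzR] at h1
      have h2 : h z ≤ 2 * ε * R := by simp only [hh, hu]; linarith
      have h3 : 0 ≤ 5 * ε * (poissonKernel 0 (w 1) z * h z) := by positivity
      have h4 : 0 ≤ 5 * ε * (poissonKernel 0 (w (-1)) z * h z) := by positivity
      linarith
  have hi1 := hhint.poissonKernel_mul (hwb 1 (Or.inl rfl))
  have hi2 := hhint.poissonKernel_mul (hwb (-1) (Or.inr rfl))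
  have hi3 : CircleIntegrable (fun z => (5 * ε) • (poissonKernel 0 (w 1) z * h z)) 0 R :=
    hi1.const_smul
  have hi4 : CircleIntegrable (fun z => (5 * ε) • (poissonKernel 0 (w (-1)) z * h z)) 0 R :=
    hi2.const_smul
  have hi5 : CircleIntegrable (fun z => (5 * ε) • (poissonKernel 0 (w 1) z * h z) +
    (5 * ε) • (poissonKernel 0 (w (-1)) z * h z)) 0 R := hi3.add hi4
  have hi6 : CircleIntegrable (fun _ : ℂ => 2 * ε * R) 0 R :=
    continuous_const.continuousOn.circleIntegrable'
  have hup : circleAverage h 0 R ≤ 2 * ε * R + (5 * ε * ((V + 2 * ε) * R) +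
      5 * ε * ((V + 2 * ε) * R)) := by
    refine (circleAverage_mono hhint (hi6.add hi5) hpt).trans ?_
    rw [circleAverage_add hi6 hi5, circleAverage_const, circleAverage_fun_add hi3 hi4,
      circleAverage_fun_smul, circleAverage_fun_smul, smul_eq_mul, smul_eq_mul]
    gcongr
    · exact hPavg 1 (Or.inl rfl)
    · exact hPavg (-1) (Or.inr rfl)
  have hlo : 0 ≤ circleAverage h 0 R := circleAverage_nonneg_of_nonneg hh0
  rw [havg, abs_le]
  have e1 : 0 < ε * R := mul_pos hε hR
  have e2 : 0 ≤ V * (ε * R) := by positivity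
  have e3 : ε * (ε * R) ≤ 1 / 2 * (ε * R) := mul_le_mul_of_nonneg_right hε' e1.le
  constructor <;> nlinarith

/-- An entire function `f` whose modulus is `exp (V (Im z)⁻ + o(|z|))`, from above everywhere and
from below outside arbitrarily small angles around the real axis, has
`(1 / 2π) ∫ log |f (R e^{iθ})| dθ ~ V R / π`. -/
theorem tendsto_circleAverage_log_norm_div {f : ℂ → ℂ} (hf : AnalyticOnNhd ℂ f Set.univ) {V : ℝ}
    (hV : 0 ≤ V)
    (hupper : ∀ ε > 0, ∃ R₀ : ℝ, ∀ z : ℂ, R₀ ≤ ‖z‖ →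
      ‖f z‖ ≤ exp (V * max (-z.im) 0 + ε * ‖z‖))
    (hlower : ∀ ε > 0, ∃ R₀ : ℝ, ∀ z : ℂ, R₀ ≤ ‖z‖ → ε * ‖z‖ ≤ |z.im| →
      exp (V * max (-z.im) 0 - ε * ‖z‖) ≤ ‖f z‖) :
    Tendsto (fun R : ℝ => circleAverage (fun z => log ‖f z‖) 0 R / R) atTop (𝓝 (V / π)) := by
  rw [Metric.tendsto_atTop]
  intro δ hδ
  set ε : ℝ := min (1 / 2) (δ / (2 * (10 * V + 23))) with hεdef
  have hC : 0 < 10 * V + 23 := by positivity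
  have hε : 0 < ε := lt_min (by norm_num) (by positivity)
  obtain ⟨R₁, h₁⟩ := hupper ε hε
  obtain ⟨R₂, h₂⟩ := hlower ε hε
  refine ⟨max 1 (max R₁ (2 * R₂)), fun R hR => ?_⟩
  have hR1 : 1 ≤ R := (le_max_left _ _).trans hR
  have hR2 : R₁ ≤ R := (le_max_left _ _).trans ((le_max_right _ _).trans hR)
  have hR3 : 2 * R₂ ≤ R := (le_max_right _ _).trans ((le_max_right _ _).trans hR)
  have hR0 : 0 < R := by linarith
  have key := abs_circleAverage_log_norm_sub_le hf hV hε (min_le_left _ _) hR0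
    (fun z hz => by simpa [hz] using h₁ z (by rw [hz]; exact hR2))
    (fun z hz _ him => h₂ z (by linarith) him)
  rw [Real.dist_eq]
  have e : circleAverage (fun z => log ‖f z‖) 0 R / R - V / π =
      (circleAverage (fun z => log ‖f z‖) 0 R - V * R / π) / R := by
    field_simp
  rw [e, abs_div, abs_of_pos hR0, div_lt_iff₀ hR0]
  refine key.trans_lt ?_
  gcongr
  have : ε ≤ δ / (2 * (10 * V + 23)) := min_le_right _ _
  rw [le_div_iff₀ (by positivity)] at this
  linarith

end RegularGrowth

/-! ### From circle averages to the number of zeros -/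

section ZeroCounting

open Metric Real MeromorphicOn Function

/-- A Tauberian step: if the increments of `M` over `[R, l R]` are squeezed between `n R log l` and
`n (l R) log l`, as for `M R = ∫₀ᴿ n(t) dt / t`, then `M R ~ c R` forces `n R ~ c R`. -/
lemma tendsto_div_of_mul_log_bounds {n M : ℝ → ℝ} {c : ℝ} (hc : 0 ≤ c)
    (hlow : ∀ R l : ℝ, 0 < R → 1 < l → n R * log l ≤ M (l * R) - M R)
    (hupp : ∀ R l : ℝ, 0 < R → 1 < l → M (l * R) - M R ≤ n (l * R) * log l)
    (hM : Tendsto (fun R => M R / R) atTop (𝓝 c)) :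
    Tendsto (fun R => n R / R) atTop (𝓝 c) := by
  have hscale : ∀ l : ℝ, 0 < l → Tendsto (fun R => M (l * R) / R) atTop (𝓝 (l * c)) := by
    intro l hl
    have h1 : Tendsto (fun R : ℝ => l * (M (l * R) / (l * R))) atTop (𝓝 (l * c)) :=
      (hM.comp (tendsto_id.const_mul_atTop hl)).const_mul l
    refine h1.congr' ?_
    filter_upwards [eventually_gt_atTop 0] with R hR
    field_simp
  have hlim : Tendsto (fun l : ℝ => l * c) (𝓝[>] 1) (𝓝 c) := by
    have : ContinuousAt (fun l : ℝ => l * c) 1 := by fun_prop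
    simpa using this.tendsto.mono_left nhdsWithin_le_nhds
  have hlim' : Tendsto (fun l : ℝ => l⁻¹ * c) (𝓝[>] 1) (𝓝 c) := by
    have : ContinuousAt (fun l : ℝ => l⁻¹ * c) 1 := by fun_prop (disch := norm_num)
    simpa using this.tendsto.mono_left nhdsWithin_le_nhds
  rw [tendsto_order]
  constructor
  · intro a ha
    obtain ⟨l, hal, hl⟩ := ((hlim'.eventually (lt_mem_nhds ha)).and self_mem_nhdsWithin).exists
    have hl1 : (1 : ℝ) < l := hl
    have hl0 : 0 < l := by linarith
    have hlog : 0 < log l := log_pos hl1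
    have h2 : Tendsto (fun R => (M R / R - M (l⁻¹ * R) / R) / log l) atTop
        (𝓝 ((c - l⁻¹ * c) / log l)) :=
      (hM.sub (hscale l⁻¹ (inv_pos.2 hl0))).div_const _
    have h3 : a < (c - l⁻¹ * c) / log l := by
      refine hal.trans_le ?_
      rw [le_div_iff₀ hlog]
      have : log l ≤ l - 1 := log_le_sub_one_of_pos hl0
      have h4 : l⁻¹ * (l - 1) = 1 - l⁻¹ := by field_simp
      calc l⁻¹ * c * log l ≤ l⁻¹ * c * (l - 1) := by gcongr
        _ = c - l⁻¹ * c := by linear_combination c * h4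
    filter_upwards [h2.eventually (lt_mem_nhds h3), eventually_gt_atTop 0] with R hR hR0
    refine hR.trans_le ?_
    have := hupp (l⁻¹ * R) l (by positivity) hl1
    rw [mul_inv_cancel_left₀ hl0.ne'] at this
    rw [← sub_div, div_div, div_le_div_iff₀ (by positivity) hR0]
    nlinarith
  · intro b hb
    obtain ⟨l, hal, hl⟩ := ((hlim.eventually (gt_mem_nhds hb)).and self_mem_nhdsWithin).exists
    have hl1 : (1 : ℝ) < l := hl
    have hl0 : 0 < l := by linarith
    have hlog : 0 < log l := log_pos hl1
    have h2 : Tendsto (fun R => (M (l * R) / R - M R / R) / log l) atTop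
        (𝓝 ((l * c - c) / log l)) :=
      ((hscale l hl0).sub hM).div_const _
    have h3 : (l * c - c) / log l < b := by
      refine lt_of_le_of_lt ?_ hal
      rw [div_le_iff₀ hlog]
      have : 1 - l⁻¹ ≤ log l := one_sub_inv_le_log_of_pos hl0
      have h4 : l * (1 - l⁻¹) = l - 1 := by field_simp
      calc l * c - c = l * c * (1 - l⁻¹) := by linear_combination -c * h4
        _ ≤ l * c * log l := by gcongr
    filter_upwards [h2.eventually (gt_mem_nhds h3), eventually_gt_atTop 0] with R hR hR0
    refine lt_of_le_of_lt ?_ hR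
    have := hlow R l hR0 hl1
    rw [← sub_div, div_div, div_le_div_iff₀ hR0 (by positivity)]
    nlinarith

/-- The number of points of `D` in the closed disc of radius `r`, with multiplicities. -/
noncomputable def discCount (D : locallyFinsupp ℂ ℤ) (r : ℝ) : ℝ :=
  ∑ᶠ z, (locallyFinsuppWithin.toClosedBall r D z : ℝ)

/-- The contribution of a point at distance `x` from the origin to the logarithmic counting
function at radius `r`; a point at the origin contributes `log r`. -/
noncomputable def logWeight (r x : ℝ) : ℝ :=
  if x = 0 then log r else if x ≤ r then log (r * x⁻¹) else 0

lemma toClosedBall_apply (D : locallyFinsupp ℂ ℤ) {r : ℝ} (hr : 0 ≤ r) (z : ℂ) :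
    locallyFinsuppWithin.toClosedBall r D z = if ‖z‖ ≤ r then D z else 0 := by
  split_ifs with h
  · exact locallyFinsuppWithin.toClosedBall_eval_within D (by simpa [abs_of_nonneg hr] using h)
  · apply locallyFinsuppWithin.apply_eq_zero_of_notMem
    simpa [abs_of_nonneg hr] using h

lemma finite_support_inter_closedBall (D : locallyFinsupp ℂ ℤ) (r : ℝ) :
    {z : ℂ | D z ≠ 0 ∧ ‖z‖ ≤ r}.Finite := by
  by_cases hr : 0 ≤ r
  · refine ((locallyFinsuppWithin.toClosedBall r D).finiteSupport
      (isCompact_closedBall 0 |r|)).subset ?_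
    rintro z ⟨hz, hzr⟩
    simpa [toClosedBall_apply D hr, hzr] using hz
  · convert Set.finite_empty
    ext z
    simp only [Set.mem_ofPred_eq, Set.mem_empty_iff_false, iff_false, not_and]
    intro _ h
    exact hr ((norm_nonneg z).trans h)

lemma discCount_eq_sum (D : locallyFinsupp ℂ ℤ) {r s : ℝ} (hr : 0 ≤ r) (hrs : r ≤ s) :
    discCount D r = ∑ z ∈ (finite_support_inter_closedBall D s).toFinset,
      (D z : ℝ) * if ‖z‖ ≤ r then 1 else 0 := by
  rw [discCount, finsum_eq_sum_of_support_subset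
    (s := (finite_support_inter_closedBall D s).toFinset)]
  · refine Finset.sum_congr rfl fun z _ => ?_
    rw [toClosedBall_apply D hr]
    split_ifs <;> simp
  · intro z hz
    simp only [mem_support, toClosedBall_apply D hr] at hz
    split_ifs at hz with h
    · simpa using ⟨by simpa using hz, h.trans hrs⟩
    · simp at hz

lemma logCounting_eq_sum (D : locallyFinsupp ℂ ℤ) {r s : ℝ} (hr : 0 ≤ r) (hrs : r ≤ s) :
    locallyFinsuppWithin.logCounting D r =
      ∑ z ∈ (finite_support_inter_closedBall D s).toFinset, (D z : ℝ) * logWeight r ‖z‖ := by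
  classical
  have h0 : (D 0 : ℝ) * log r = ∑ z ∈ (finite_support_inter_closedBall D s).toFinset,
      if z = 0 then (D z : ℝ) * log r else 0 := by
    rw [Finset.sum_ite_eq']
    split_ifs with h
    · rfl
    · have : D 0 = 0 := by
        by_contra hD
        exact h (by simpa using ⟨hD, hr.trans hrs⟩)
      simp [this]
  have h1 : locallyFinsuppWithin.logCounting D r =
      ∑ᶠ z, (locallyFinsuppWithin.toClosedBall r D z : ℝ) * log (r * ‖z‖⁻¹) + D 0 * log r := rfl
  rw [h1, h0, finsum_eq_sum_of_support_subset
    (s := (finite_support_inter_closedBall D s).toFinset), ← Finset.sum_add_distrib]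
  · refine Finset.sum_congr rfl fun z _ => ?_
    rw [toClosedBall_apply D hr, logWeight]
    by_cases hz : z = 0
    · simp [hz]
    · by_cases hzr : ‖z‖ ≤ r <;> simp [hz, hzr]
  · intro z hz
    simp only [mem_support, toClosedBall_apply D hr] at hz
    split_ifs at hz with h
    · simpa using ⟨by rintro h'; simp [h'] at hz, h.trans hrs⟩
    · simp at hz

lemma logWeight_sub_bounds {R l x : ℝ} (hR : 0 < R) (hl : 1 < l) (hx : 0 ≤ x)
    (hxl : x ≤ l * R) :
    (if x ≤ R then 1 else 0) * log l ≤ logWeight (l * R) x - logWeight R x ∧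
      logWeight (l * R) x - logWeight R x ≤ log l := by
  have hl0 : 0 < l := by linarith
  have hlog := log_pos hl
  by_cases h0 : x = 0
  · simp [logWeight, h0, log_mul hl0.ne' hR.ne', hR.le]
  have hx0 : 0 < x := lt_of_le_of_ne hx (Ne.symm h0)
  by_cases hxR : x ≤ R
  · simp [logWeight, h0, hxR, hxl, log_mul, hl0.ne', hR.ne']
  · simp only [logWeight, h0, hxR, hxl, if_true, if_false, sub_zero, zero_mul]
    constructor
    · apply log_nonneg
      rw [← div_eq_mul_inv, one_le_div hx0]
      exact hxl
    · apply log_le_log (by positivity)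
      rw [← div_eq_mul_inv, div_le_iff₀ hx0]
      nlinarith

lemma discCount_mul_log_le {D : locallyFinsupp ℂ ℤ} (hD : ∀ z, 0 ≤ D z) {R l : ℝ} (hR : 0 < R)
    (hl : 1 < l) :
    discCount D R * log l ≤
      locallyFinsuppWithin.logCounting D (l * R) - locallyFinsuppWithin.logCounting D R := by
  have hRl : R ≤ l * R := by nlinarith
  rw [discCount_eq_sum D hR.le hRl, logCounting_eq_sum D (by positivity) le_rfl,
    logCounting_eq_sum D hR.le hRl, Finset.sum_mul, ← Finset.sum_sub_distrib]
  refine Finset.sum_le_sum fun z hz => ?_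
  have hz' : D z ≠ 0 ∧ ‖z‖ ≤ l * R := by simpa using hz
  rw [mul_assoc, ← mul_sub]
  exact mul_le_mul_of_nonneg_left (logWeight_sub_bounds hR hl (norm_nonneg z) hz'.2).1
    (by exact_mod_cast hD z)

lemma logCounting_sub_le_discCount {D : locallyFinsupp ℂ ℤ} (hD : ∀ z, 0 ≤ D z) {R l : ℝ}
    (hR : 0 < R) (hl : 1 < l) :
    locallyFinsuppWithin.logCounting D (l * R) - locallyFinsuppWithin.logCounting D R ≤
      discCount D (l * R) * log l := by
  have hRl : R ≤ l * R := by nlinarith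
  rw [discCount_eq_sum D (by positivity) le_rfl, logCounting_eq_sum D (by positivity) le_rfl,
    logCounting_eq_sum D hR.le hRl, Finset.sum_mul, ← Finset.sum_sub_distrib]
  refine Finset.sum_le_sum fun z hz => ?_
  have hz' : D z ≠ 0 ∧ ‖z‖ ≤ l * R := by simpa using hz
  rw [if_pos hz'.2, mul_one, ← mul_sub]
  exact mul_le_mul_of_nonneg_left (logWeight_sub_bounds hR hl (norm_nonneg z) hz'.2).2
    (by exact_mod_cast hD z)

lemma tsum_analyticOrderAt_eq_discCount {f : ℂ → ℂ} (hf : AnalyticOnNhd ℂ f Set.univ)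
    (hord : ∀ z, analyticOrderAt f z ≠ ⊤) {R : ℝ} (hR : 0 ≤ R) :
    ∑' k : {k : ℂ // ‖k‖ ≤ R}, ((analyticOrderAt f k : ℕ∞) : ℝ≥0∞) =
      ENNReal.ofReal (discCount (divisor f Set.univ) R) := by
  set D := divisor f Set.univ with hD
  have hDz : ∀ z, D z = ((analyticOrderAt f z).toNat : ℤ) := by
    intro z
    rw [hD, hf.divisor_apply (Set.mem_univ z)]
    obtain ⟨n, hn⟩ := ENat.ne_top_iff_exists.1 (hord z)
    rw [← hn]; simp
  have hcast : ∀ z, ((analyticOrderAt f z : ℕ∞) : ℝ≥0∞) = ENNReal.ofReal (D z : ℝ) := by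
    intro z
    rw [hDz]
    obtain ⟨n, hn⟩ := ENat.ne_top_iff_exists.1 (hord z)
    rw [← hn]; simp
  have hnn : ∀ z, (0 : ℝ) ≤ D z := fun z => by rw [hDz]; positivity
  rw [discCount_eq_sum D hR le_rfl, ENNReal.ofReal_sum_of_nonneg (fun z _ =>
    mul_nonneg (hnn z) (by split_ifs <;> norm_num))]
  have h1 : ∑' k : {k : ℂ // ‖k‖ ≤ R}, ((analyticOrderAt f k : ℕ∞) : ℝ≥0∞) =
      ∑' k : ℂ, Set.indicator {k : ℂ | ‖k‖ ≤ R} (fun k => ENNReal.ofReal (D k : ℝ)) k := by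
    rw [← tsum_subtype]
    exact tsum_congr fun k => hcast k
  rw [h1, tsum_eq_sum (s := (finite_support_inter_closedBall D R).toFinset)]
  · refine Finset.sum_congr rfl fun z hz => ?_
    have hz' : D z ≠ 0 ∧ ‖z‖ ≤ R := by simpa using hz
    simp [Set.indicator, hz'.2]
  · intro z hz
    simp only [Set.Finite.mem_toFinset, Set.mem_ofPred_eq, not_and] at hz
    by_cases h : D z = 0
    · simp [Set.indicator, h]
    · simp [Set.indicator, hz h]

/-- The number of zeros in the disc of radius `R` of an entire function `f` with
`log |f| = V (Im z)⁻ + o(|z|)` is asymptotic to `V R / π`. -/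
theorem tendsto_tsum_analyticOrderAt_div {f : ℂ → ℂ} (hf : AnalyticOnNhd ℂ f Set.univ) {V : ℝ}
    (hV : 0 ≤ V)
    (hupper : ∀ ε > 0, ∃ R₀ : ℝ, ∀ z : ℂ, R₀ ≤ ‖z‖ →
      ‖f z‖ ≤ exp (V * max (-z.im) 0 + ε * ‖z‖))
    (hlower : ∀ ε > 0, ∃ R₀ : ℝ, ∀ z : ℂ, R₀ ≤ ‖z‖ → ε * ‖z‖ ≤ |z.im| →
      exp (V * max (-z.im) 0 - ε * ‖z‖) ≤ ‖f z‖) :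
    Tendsto (fun R : ℝ => (∑' k : {k : ℂ // ‖k‖ ≤ R}, ((analyticOrderAt f k : ℕ∞) : ℝ≥0∞)) /
      ENNReal.ofReal R) atTop (𝓝 (ENNReal.ofReal (V / π))) := by
  have hne : ∃ z, f z ≠ 0 := by
    obtain ⟨R₀, h⟩ := hlower 1 one_pos
    refine ⟨(|R₀| : ℝ) * Complex.I, norm_pos_iff.1 ((exp_pos _).trans_le (h _ ?_ ?_))⟩
    · simpa using le_abs_self R₀
    · simp
  have hord : ∀ z, analyticOrderAt f z ≠ ⊤ := by
    obtain ⟨z₀, hz₀⟩ := hne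
    intro z
    refine hf.analyticOrderAt_ne_top_of_isPreconnected isPreconnected_univ (Set.mem_univ z₀)
      (Set.mem_univ z) ?_
    rw [(hf z₀ (Set.mem_univ _)).analyticOrderAt_eq_zero.2 hz₀]
    simp
  set D := divisor f Set.univ with hD
  have hDnn : ∀ z, 0 ≤ D z := fun z => (hf.divisor_nonneg) z
  have hmer : Meromorphic f := fun z => (hf z (Set.mem_univ z)).meromorphicAt
  have hjensen : ∀ R : ℝ, 0 < R → locallyFinsuppWithin.logCounting D R =
      circleAverage (fun z => log ‖f z‖) 0 R - log ‖meromorphicTrailingCoeffAt f 0‖ := fun R hR =>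
    locallyFinsuppWithin.logCounting_divisor_eq_circleAverage_sub_const hmer hR.ne'
  have hn : Tendsto (fun R => discCount D R / R) atTop (𝓝 (V / π)) := by
    refine tendsto_div_of_mul_log_bounds (M := locallyFinsuppWithin.logCounting D)
      (by positivity) (fun R l hR hl => discCount_mul_log_le hDnn hR hl)
      (fun R l hR hl => logCounting_sub_le_discCount hDnn hR hl) ?_
    have h1 := (tendsto_circleAverage_log_norm_div hf hV hupper hlower).sub
      (tendsto_const_nhds (x := log ‖meromorphicTrailingCoeffAt f 0‖) |>.div_atTop tendsto_id)
    rw [sub_zero] at h1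
    refine h1.congr' ?_
    filter_upwards [eventually_gt_atTop 0] with R hR
    rw [hjensen R hR, sub_div]
    rfl
  refine ((ENNReal.continuous_ofReal.tendsto _).comp hn).congr' ?_
  filter_upwards [eventually_gt_atTop 0] with R hR
  rw [tsum_analyticOrderAt_eq_discCount hf hord hR.le, Function.comp_apply,
    ENNReal.ofReal_div_of_pos hR]

end ZeroCounting

/-! ### Permutations with the same undirected edges -/

section EdgeCount

open Equiv


/-- The multiplicity of the undirected edge `{i, j}` in the multigraph with edges `{k, σ k}`. -/
def edgeCount {ι : Type*} [DecidableEq ι] (σ : Perm ι) (i j : ι) : ℕ :=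
  (if σ i = j then 1 else 0) + (if σ j = i then 1 else 0)

lemma apply_eq_self_iff_of_edgeCount_eq {ι : Type*} [DecidableEq ι] {σ τ : Perm ι}
    (h : ∀ i j, edgeCount σ i j = edgeCount τ i j) (i : ι) : σ i = i ↔ τ i = i := by
  have := h i i
  simp only [edgeCount] at this
  by_cases h1 : σ i = i <;> by_cases h2 : τ i = i <;> simp_all

lemma apply_eq_or_of_edgeCount_eq {ι : Type*} [DecidableEq ι] {σ τ : Perm ι}
    (h : ∀ i j, edgeCount σ i j = edgeCount τ i j) (i : ι) :
    τ i = σ i ∨ τ i = σ.symm i := by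
  have := h i (τ i)
  simp only [edgeCount, if_true] at this
  by_cases h1 : σ i = τ i
  · exact Or.inl h1.symm
  · by_cases h2 : σ (τ i) = i
    · exact Or.inr ((Equiv.eq_symm_apply σ).2 h2)
    · simp [h1, h2] at this
      omega

variable {ι : Type*} [Fintype ι] [DecidableEq ι]

lemma sum_edgeCount (σ : Perm ι) (i : ι) : ∑ j, edgeCount σ i j = 2 := by
  have h : ∀ j, σ j = i ↔ j = σ.symm i := fun j => (Equiv.eq_symm_apply σ).symm
  simp [edgeCount, Finset.sum_add_distrib, h]

lemma edgeCount_eq_of_off_diag {σ τ : Perm ι}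
    (h : ∀ i j, i ≠ j → edgeCount σ i j = edgeCount τ i j) (i j : ι) :
    edgeCount σ i j = edgeCount τ i j := by
  by_cases hij : i = j
  · subst hij
    have h1 := sum_edgeCount σ i
    have h2 := sum_edgeCount τ i
    rw [← Finset.add_sum_erase _ _ (Finset.mem_univ i)] at h1 h2
    have h3 : ∑ j ∈ Finset.univ.erase i, edgeCount σ i j =
        ∑ j ∈ Finset.univ.erase i, edgeCount τ i j :=
      Finset.sum_congr rfl fun j hj => h i j (Finset.ne_of_mem_erase hj).symm
    omega
  · exact h i j hij

lemma apply_apply_eq_iff_of_edgeCount_eq {σ τ : Perm ι}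
    (h : ∀ i j, edgeCount σ i j = edgeCount τ i j) (i : ι) :
    τ (σ i) = σ (σ i) ↔ τ i = σ i := by
  have hfwd : ∀ i, τ i = σ i → τ (σ i) = σ (σ i) := by
    intro i hi
    have := h (σ i) (σ (σ i))
    by_cases h1 : τ (σ i) = σ (σ i)
    · exact h1
    · simp only [edgeCount, if_true, h1, if_false] at this
      by_cases h2 : τ (σ (σ i)) = σ i
      · have h3 : σ (σ i) = i := τ.injective (h2.trans hi.symm)
        simp [h3] at this
        split_ifs at this
        omega
      · simp [h2] at this
  refine ⟨fun hi => ?_, hfwd i⟩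
  -- `{τ = σ}` is a finite set mapped into itself by `σ`, hence mapped onto itself
  have hmaps : ∀ x : {i // τ i = σ i}, τ (σ x) = σ (σ x) := fun x => hfwd x x.2
  have hinj : Function.Injective fun x : {i // τ i = σ i} =>
      (⟨σ x, hmaps x⟩ : {i // τ i = σ i}) := by
    intro x y hxy
    simpa [Subtype.ext_iff] using hxy
  obtain ⟨y, hy⟩ := (Finite.injective_iff_surjective.1 hinj) ⟨σ i, hi⟩
  have : (y : ι) = i := σ.injective (by simpa [Subtype.ext_iff] using hy)
  exact this ▸ y.2

/-- If `σ` and `τ` have the same undirected edges, then `τ` arises from `σ` by reversing some of its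
cycles; so `τ = ρ⁻² σ`, where `ρ` is the product of the cycles to be reversed. -/
lemma sign_eq_of_edgeCount_eq {σ τ : Perm ι}
    (h : ∀ i j, edgeCount σ i j = edgeCount τ i j) : Perm.sign σ = Perm.sign τ := by
  have hinv : ∀ i, ¬ τ (σ i) = σ (σ i) ↔ ¬ τ i = σ i := fun i =>
    not_congr (apply_apply_eq_iff_of_edgeCount_eq h i)
  set ρ : Perm ι := Perm.ofSubtype (σ.subtypePerm (p := fun i => ¬ τ i = σ i) hinv) with hρ
  have hσ : σ = ρ * ρ * τ := by
    ext i
    simp only [Perm.mul_apply]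
    by_cases hi : τ i = σ i
    · have h1 : τ (σ i) = σ (σ i) := (apply_apply_eq_iff_of_edgeCount_eq h i).2 hi
      have h2 : ρ (σ i) = σ i := by
        rw [hρ, Perm.ofSubtype_apply_of_not_mem]
        simpa using h1
      rw [hi, h2, h2]
    · have hs := (apply_eq_or_of_edgeCount_eq h i).resolve_left hi
      have h1 : ¬ τ (τ i) = σ (τ i) := by
        intro h'
        rw [hs, ← apply_apply_eq_iff_of_edgeCount_eq h, Equiv.apply_symm_apply] at h'
        exact hi h'
      have h2 : ρ (τ i) = i := by
        rw [hρ, Perm.ofSubtype_apply_of_mem (p := fun i => ¬ τ i = σ i) _ h1]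
        simp [hs]
      have h3 : ρ i = σ i := by
        rw [hρ, Perm.ofSubtype_apply_of_mem (p := fun i => ¬ τ i = σ i) _ hi]
        simp
      rw [h2, h3]
  conv_lhs => rw [hσ]
  rw [Perm.sign_mul, Perm.sign_mul, Int.units_mul_self, one_mul]

lemma prod_eq_of_edgeCount_eq {M : Type*} [CommMonoid M] {g : ι → ι → M}
    (hg : ∀ i j, g i j = g j i) {σ τ : Perm ι}
    (h : ∀ i j, edgeCount σ i j = edgeCount τ i j) :
    ∏ i, g (σ i) i = ∏ i, g (τ i) i := by
  rw [← Finset.prod_filter_mul_prod_filter_not Finset.univ (fun i => τ i = σ i),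
    ← Finset.prod_filter_mul_prod_filter_not Finset.univ (fun i => τ i = σ i)
      (fun i => g (τ i) i)]
  congr 1
  · exact Finset.prod_congr rfl fun i hi => by rw [(Finset.mem_filter.1 hi).2]
  · refine Finset.prod_bij (fun i _ => σ i) ?_ (fun i _ j _ hij => σ.injective hij) ?_ ?_
    · intro i hi
      simp only [Finset.mem_filter, Finset.mem_univ, true_and] at hi ⊢
      rwa [apply_apply_eq_iff_of_edgeCount_eq h]
    · intro j hj
      refine ⟨σ.symm j, ?_, by simp⟩
      simp only [Finset.mem_filter, Finset.mem_univ, true_and] at hj ⊢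
      rwa [← apply_apply_eq_iff_of_edgeCount_eq h, Equiv.apply_symm_apply]
    · intro i hi
      simp only [Finset.mem_filter, Finset.mem_univ, true_and] at hi
      have h1 : ¬ τ (σ i) = σ (σ i) := by rwa [apply_apply_eq_iff_of_edgeCount_eq h]
      rw [(apply_eq_or_of_edgeCount_eq h (σ i)).resolve_left h1, Equiv.symm_apply_apply, hg]

end EdgeCount

/-! ### Exponential polynomials -/

section ExponentialPolynomial

open Real

lemma exists_forall_const_mul_pow_le_exp (C a : ℝ) (m : ℕ) {ε : ℝ} (hC : 0 ≤ C) (ha : 0 ≤ a)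
    (hε : 0 < ε) : ∃ R₀ : ℝ, ∀ x, R₀ ≤ x → C * (a + x) ^ m ≤ exp (ε * x) := by
  have h1 : Tendsto (fun x : ℝ => C * 2 ^ m * (x ^ m / exp (ε * x))) atTop (𝓝 (C * 2 ^ m * 0)) :=
    (isLittleO_pow_exp_pos_mul_atTop m hε).tendsto_div_nhds_zero.const_mul _
  rw [mul_zero] at h1
  obtain ⟨R₁, hR₁⟩ := eventually_atTop.1 (h1.eventually (gt_mem_nhds one_pos))
  refine ⟨max R₁ a, fun x hx => ?_⟩
  have hxa : a ≤ x := (le_max_right _ _).trans hx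
  have h2 := hR₁ x ((le_max_left _ _).trans hx)
  rw [← mul_div_assoc, div_lt_one (exp_pos _)] at h2
  refine le_trans ?_ h2.le
  calc C * (a + x) ^ m ≤ C * (2 * x) ^ m := by
        gcongr
        · linarith
        · linarith
    _ = C * 2 ^ m * x ^ m := by rw [mul_pow]; ring

variable {ι : Type*} [Fintype ι] {α : ℂ} {s : ι → ℂ} {p : ι → ℕ} {L : ι → ℝ} {f : ℂ → ℂ}

lemma norm_affine_le (α z : ℂ) :
    ‖α - Complex.I * z / (4 * (π : ℂ))‖ ≤ 1 + ‖α‖ + ‖z‖ := by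
  have h1 : ‖Complex.I * z / (4 * (π : ℂ))‖ ≤ ‖z‖ := by
    rw [norm_div, norm_mul, Complex.norm_I, one_mul, norm_mul, Complex.norm_real,
      norm_of_nonneg pi_pos.le]
    apply div_le_self (norm_nonneg _)
    have := pi_gt_three
    norm_num
    linarith
  linarith [norm_sub_le α (Complex.I * z / (4 * (π : ℂ)))]

lemma one_le_norm_affine {α z : ℂ} (hz : 4 * π * (1 + ‖α‖) ≤ ‖z‖) :
    1 ≤ ‖α - Complex.I * z / (4 * (π : ℂ))‖ := by
  have h1 : 1 + ‖α‖ ≤ ‖Complex.I * z / (4 * (π : ℂ))‖ := by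
    rw [norm_div, norm_mul, Complex.norm_I, one_mul, norm_mul, Complex.norm_real,
      norm_of_nonneg pi_pos.le, le_div_iff₀ (by simp [pi_pos])]
    norm_num
    linarith
  have := norm_sub_norm_le (Complex.I * z / (4 * (π : ℂ))) α
  rw [norm_sub_rev] at this
  linarith

lemma norm_affine_pow_le {n m : ℕ} (hnm : n ≤ m) (α z : ℂ) :
    ‖α - Complex.I * z / (4 * (π : ℂ))‖ ^ n ≤ (1 + ‖α‖ + ‖z‖) ^ m := by
  calc ‖α - Complex.I * z / (4 * (π : ℂ))‖ ^ n ≤ (1 + ‖α‖ + ‖z‖) ^ n := by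
        gcongr
        exact norm_affine_le α z
    _ ≤ (1 + ‖α‖ + ‖z‖) ^ m :=
        pow_le_pow_right₀ (by linarith [norm_nonneg α, norm_nonneg z]) hnm

lemma norm_cexp_I_mul_ofReal (z : ℂ) (l : ℝ) :
    ‖Complex.exp (Complex.I * z * l)‖ = exp (-(l * z.im)) := by
  rw [Complex.norm_exp]
  congr 1
  simp [Complex.mul_re, Complex.mul_im]
  ring

/-- Upper bound for exponential polynomials with frequencies in `[0, V]`. -/
lemma expPoly_upper_bound {m : ℕ} {V : ℝ}
    (hf : ∀ z, f z = ∑ i, s i * (α - Complex.I * z / (4 * (π : ℂ))) ^ p i *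
      Complex.exp (Complex.I * z * L i))
    (hp : ∀ i, p i ≤ m) (hL : ∀ i, 0 ≤ L i ∧ L i ≤ V) {ε : ℝ} (hε : 0 < ε) :
    ∃ R₀ : ℝ, ∀ z : ℂ, R₀ ≤ ‖z‖ → ‖f z‖ ≤ exp (V * max (-z.im) 0 + ε * ‖z‖) := by
  obtain ⟨R₀, h₀⟩ := exists_forall_const_mul_pow_le_exp (∑ i, ‖s i‖) (1 + ‖α‖) m
    (by positivity) (by positivity) hε
  refine ⟨R₀, fun z hz => ?_⟩
  rw [hf, add_comm, exp_add]
  calc ‖∑ i, s i * (α - Complex.I * z / (4 * (π : ℂ))) ^ p i * Complex.exp (Complex.I * z * L i)‖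
      ≤ ∑ i, ‖s i‖ * (1 + ‖α‖ + ‖z‖) ^ m * exp (V * max (-z.im) 0) := by
        refine norm_sum_le_of_le _ fun i _ => ?_
        rw [norm_mul, norm_mul, norm_pow, norm_cexp_I_mul_ofReal]
        have h1 : -(L i * z.im) ≤ V * max (-z.im) 0 := by
          calc -(L i * z.im) = L i * (-z.im) := by ring
            _ ≤ L i * max (-z.im) 0 := mul_le_mul_of_nonneg_left (le_max_left _ _) (hL i).1
            _ ≤ V * max (-z.im) 0 := mul_le_mul_of_nonneg_right (hL i).2 (le_max_right _ _)
        gcongr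
        exact norm_affine_pow_le (hp i) α z
    _ = (∑ i, ‖s i‖) * (1 + ‖α‖ + ‖z‖) ^ m * exp (V * max (-z.im) 0) := by
        rw [Finset.sum_mul, Finset.sum_mul]
    _ ≤ exp (ε * ‖z‖) * exp (V * max (-z.im) 0) := by
        gcongr
        exact h₀ _ hz

/-- Where the frequency `l` dominates and the terms of frequency `l` all coincide, an exponential
polynomial is bounded below by `c |e^{izl}|`. -/
lemma expPoly_lower_bound {m : ℕ} {l : ℝ}
    (hf : ∀ z, f z = ∑ i, s i * (α - Complex.I * z / (4 * (π : ℂ))) ^ p i *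
      Complex.exp (Complex.I * z * L i))
    (hp : ∀ i, p i ≤ m) (hs : ∀ i, s i ≠ 0) (hl : ∃ i, L i = l)
    (heq : ∀ i j, L i = l → L j = l → s i = s j ∧ p i = p j) {ε : ℝ} (hε : 0 < ε) :
    ∃ R₀ : ℝ, ∀ z : ℂ, R₀ ≤ ‖z‖ → (∀ i, ε * |L i - l| * ‖z‖ ≤ (L i - l) * z.im) →
      exp (-(l * z.im) - ε * ‖z‖) ≤ ‖f z‖ := by
  classical
  obtain ⟨i₀, hi₀⟩ := hl
  -- the gap between `l` and the other frequencies
  obtain ⟨g, hg, hgap⟩ : ∃ g : ℝ, 0 < g ∧ ∀ i, L i ≠ l → g ≤ |L i - l| := by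
    have : ∀ i, ∀ᶠ g : ℝ in 𝓝[>] 0, L i ≠ l → g ≤ |L i - l| := by
      intro i
      by_cases h : L i = l
      · simp [h]
      · have : 0 < |L i - l| := abs_pos.2 (sub_ne_zero.2 h)
        filter_upwards [nhdsWithin_le_nhds (gt_mem_nhds this)] with g hg _ using hg.le
    obtain ⟨g, hg, hg0⟩ := ((eventually_all.2 this).and self_mem_nhdsWithin).exists
    exact ⟨g, hg0, hg⟩
  set δ : ℝ := ‖s i₀‖ with hδ
  have hδ0 : 0 < δ := norm_pos_iff.2 (hs i₀)
  obtain ⟨R₁, h₁⟩ := exists_forall_const_mul_pow_le_exp (2 / δ * ∑ i, ‖s i‖) (1 + ‖α‖) m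
    (by positivity) (by positivity) (mul_pos hε hg)
  -- with exponent `0` this says `2 / δ ≤ exp (ε x)`
  obtain ⟨R₂, h₂⟩ := exists_forall_const_mul_pow_le_exp (2 / δ) 0 0
    (by positivity) le_rfl hε
  refine ⟨max (4 * π * (1 + ‖α‖)) (max R₁ R₂), fun z hz hdom => ?_⟩
  have hz0 := (le_max_left _ _).trans hz
  have hz1 := h₁ _ ((le_max_left _ _).trans ((le_max_right _ _).trans hz))
  have hz2 := h₂ _ ((le_max_right _ _).trans ((le_max_right _ _).trans hz))
  set q : ℂ := α - Complex.I * z / (4 * (π : ℂ)) with hq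
  have hq1 : 1 ≤ ‖q‖ := one_le_norm_affine hz0
  have hsplit : f z = Complex.exp (Complex.I * z * l) *
      (∑ i with L i = l, s i * q ^ p i +
        ∑ i with ¬ L i = l, s i * q ^ p i * Complex.exp (Complex.I * z * ((L i - l : ℝ) : ℂ))) := by
    rw [hf, ← Finset.sum_filter_add_sum_filter_not Finset.univ (fun i => L i = l), mul_add,
      Finset.mul_sum, Finset.mul_sum]
    congr 1
    · refine Finset.sum_congr rfl fun i hi => ?_
      rw [(Finset.mem_filter.1 hi).2]; ring
    · refine Finset.sum_congr rfl fun i _ => ?_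
      have : Complex.I * z * (L i : ℂ) =
          Complex.I * z * l + Complex.I * z * ((L i - l : ℝ) : ℂ) := by
        push_cast; ring
      rw [this, Complex.exp_add]; ring
  have hmain : δ ≤ ‖∑ i with L i = l, s i * q ^ p i‖ := by
    have h3 : ∑ i with L i = l, s i * q ^ p i =
        ((Finset.univ.filter fun i => L i = l).card : ℂ) * (s i₀ * q ^ p i₀) := by
      rw [← nsmul_eq_mul, ← Finset.sum_const]
      refine Finset.sum_congr rfl fun i hi => ?_
      obtain ⟨e1, e2⟩ := heq i i₀ (Finset.mem_filter.1 hi).2 hi₀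
      rw [e1, e2]
    rw [h3, norm_mul, norm_mul, norm_pow, Complex.norm_natCast]
    have hcard : (1 : ℝ) ≤ ((Finset.univ.filter fun i => L i = l).card : ℝ) := by
      exact_mod_cast Finset.card_pos.2 ⟨i₀, by simpa using hi₀⟩
    have h4 : (1 : ℝ) ≤ ‖q‖ ^ p i₀ := one_le_pow₀ hq1
    calc δ = 1 * (δ * 1) := by ring
      _ ≤ _ := by gcongr
  have hrest : ‖∑ i with ¬ L i = l, s i * q ^ p i *
      Complex.exp (Complex.I * z * ((L i - l : ℝ) : ℂ))‖ ≤ δ / 2 := by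
    calc _ ≤ ∑ i with ¬ L i = l, ‖s i‖ * (1 + ‖α‖ + ‖z‖) ^ m * exp (-(ε * g * ‖z‖)) := by
          refine norm_sum_le_of_le _ fun i hi => ?_
          rw [norm_mul, norm_mul, norm_pow, norm_cexp_I_mul_ofReal]
          have h5 : ε * g * ‖z‖ ≤ (L i - l) * z.im :=
            le_trans (by gcongr; exact hgap i (Finset.mem_filter.1 hi).2) (hdom i)
          gcongr
          exact norm_affine_pow_le (hp i) α z
      _ ≤ ∑ i, ‖s i‖ * (1 + ‖α‖ + ‖z‖) ^ m * exp (-(ε * g * ‖z‖)) :=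
          Finset.sum_le_sum_of_subset_of_nonneg (Finset.filter_subset _ _)
            fun i _ _ => by positivity
      _ = δ / 2 * ((2 / δ * ∑ i, ‖s i‖) * (1 + ‖α‖ + ‖z‖) ^ m) * exp (-(ε * g * ‖z‖)) := by
          rw [← Finset.sum_mul, ← Finset.sum_mul]
          field_simp
      _ ≤ δ / 2 * exp (ε * g * ‖z‖) * exp (-(ε * g * ‖z‖)) := by gcongr
      _ = δ / 2 := by rw [mul_assoc, ← exp_add]; simp
  have hsum := norm_sub_le_norm_add (∑ i with L i = l, s i * q ^ p i)
    (∑ i with ¬ L i = l, s i * q ^ p i * Complex.exp (Complex.I * z * ((L i - l : ℝ) : ℂ)))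
  rw [hsplit, norm_mul, norm_cexp_I_mul_ofReal, sub_eq_add_neg, exp_add]
  gcongr
  rw [pow_zero, mul_one, div_le_iff₀ hδ0] at hz2
  have h6 : exp (-(ε * ‖z‖)) ≤ δ / 2 := by
    rw [exp_neg, inv_le_comm₀ (exp_pos _) (by positivity), inv_div, div_le_iff₀ hδ0]
    exact hz2
  linarith

/-- The density of zeros of an exponential polynomial with frequencies in `[0, V]`, both ends
attained and without cancellation in the terms of extreme frequency. -/
theorem expPoly_tendsto_zeroCount_div {m : ℕ} {V : ℝ}
    (hf : ∀ z, f z = ∑ i, s i * (α - Complex.I * z / (4 * (π : ℂ))) ^ p i *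
      Complex.exp (Complex.I * z * L i))
    (hp : ∀ i, p i ≤ m) (hs : ∀ i, s i ≠ 0) (hL : ∀ i, 0 ≤ L i ∧ L i ≤ V)
    (hl0 : ∃ i, L i = 0) (hlV : ∃ i, L i = V)
    (heq0 : ∀ i j, L i = 0 → L j = 0 → s i = s j ∧ p i = p j)
    (heqV : ∀ i j, L i = V → L j = V → s i = s j ∧ p i = p j) :
    Tendsto (fun R : ℝ => (∑' k : {k : ℂ // ‖k‖ ≤ R}, ((analyticOrderAt f k : ℕ∞) : ℝ≥0∞)) /
      ENNReal.ofReal R) atTop (𝓝 (ENNReal.ofReal (V / π))) := by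
  have hV : 0 ≤ V := by
    obtain ⟨i, rfl⟩ := hlV
    exact (hL i).1
  have hfa : AnalyticOnNhd ℂ f Set.univ := by
    have : f = fun z => ∑ i, s i * (α - Complex.I * z / (4 * (π : ℂ))) ^ p i *
      Complex.exp (Complex.I * z * L i) := funext hf
    rw [this]
    have hpi : (4 * (π : ℂ)) ≠ 0 := by simp
    intro z _
    fun_prop (disch := assumption)
  refine tendsto_tsum_analyticOrderAt_div hfa hV
    (fun ε hε => expPoly_upper_bound hf hp hL hε) fun ε hε => ?_
  obtain ⟨R₁, h₁⟩ := expPoly_lower_bound hf hp hs hl0 heq0 hε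
  obtain ⟨R₂, h₂⟩ := expPoly_lower_bound hf hp hs hlV heqV hε
  refine ⟨max R₁ R₂, fun z hz him => ?_⟩
  rcases le_total 0 z.im with h | h
  · have := h₁ z ((le_max_left _ _).trans hz) fun i => by
      rw [abs_of_nonneg h] at him
      rw [sub_zero, abs_of_nonneg (hL i).1]
      nlinarith [mul_le_mul_of_nonneg_left him (hL i).1]
    simpa [max_eq_right (neg_nonpos.2 h)] using this
  · have := h₂ z ((le_max_right _ _).trans hz) fun i => by
      rw [abs_of_nonpos h] at him
      have hi : L i - V ≤ 0 := by linarith [(hL i).2]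
      rw [abs_of_nonpos hi]
      nlinarith [mul_le_mul_of_nonneg_left him (neg_nonneg.2 hi)]
    rw [max_eq_left (neg_nonneg.2 h)]
    rwa [mul_neg]

end ExponentialPolynomial

/-! ### Level sets of signed sums of distances are null -/

section SumsOfDistances

open Metric

variable {E : Type*} [NormedAddCommGroup E] [InnerProductSpace ℝ E]

lemma eq_zero_of_forall_mul_add_sum_norm_eq {ι : Type*} [Fintype ι] {u : E} {b : ι → E} {n : ι → ℝ}
    {k c : ℝ} (h : ∀ t : ℝ, k * t + ∑ i, n i * ‖t • u - b i‖ = c) : k = 0 := by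
  -- the odd part of the function is `k t`, up to a bounded error
  have hbound : ∀ t : ℝ, |2 * k * t| ≤ ∑ i, |n i| * (2 * ‖b i‖) := by
    intro t
    have h1 := h t
    have h2 := h (-t)
    have h3 : 2 * k * t = ∑ i, n i * (‖(-t) • u - b i‖ - ‖t • u - b i‖) := by
      simp only [mul_sub, Finset.sum_sub_distrib]
      linarith
    rw [h3]
    refine (Finset.abs_sum_le_sum_abs _ _).trans (Finset.sum_le_sum fun i _ => ?_)
    rw [abs_mul]
    gcongr
    have e1 : ‖(-t) • u - b i‖ = ‖t • u + b i‖ := by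
      rw [← norm_neg]; congr 1; module
    have e2 : (2 * ‖b i‖) = ‖(t • u + b i) - (t • u - b i)‖ := by
      have : (t • u + b i) - (t • u - b i) = (2 : ℝ) • b i := by module
      rw [this, norm_smul]; norm_num
    rw [e1, e2]
    exact abs_norm_sub_norm_le _ _
  by_contra hk
  set C := ∑ i, |n i| * (2 * ‖b i‖)
  have := hbound ((C + 1) / (2 * k))
  rw [mul_div_cancel₀ _ (by simpa using hk)] at this
  linarith [le_abs_self (C + 1)]

/-- On a line through the origin that misses the points `b i`, the function `k ‖y‖ + ∑ nᵢ ‖y - bᵢ‖`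
is analytic on each open ray from the origin, and its continuation from the ray to the whole line,
`t ↦ k t + ∑ nᵢ ‖t u - bᵢ‖`, is not constant. -/
lemma volume_ray_inter_level_eq_zero {ι : Type*} [Fintype ι] {u : E} {b : ι → E} {n : ι → ℝ}
    {k c : ℝ} (hk : k ≠ 0) (hu : ‖u‖ = 1) (hub : ∀ i, ∀ t : ℝ, t • u ≠ b i) :
    volume {t : ℝ | 0 < t ∧ k * ‖t • u‖ + ∑ i, n i * ‖t • u - b i‖ = c} = 0 := by
  set G : ℝ → ℝ := fun t => k * t + ∑ i, n i * ‖t • u - b i‖ - c with hG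
  have hGa : AnalyticOnNhd ℝ G Set.univ := by
    intro t _
    have h1 : ∀ i, AnalyticAt ℝ (fun t : ℝ => ‖t • u - b i‖) t := by
      intro i
      have : ContDiffAt ℝ ⊤ (fun t : ℝ => t • u - b i) t := by fun_prop
      exact (this.norm ℝ (sub_ne_zero.2 (hub i t))).analyticAt
    simp only [hG]
    have h2 : AnalyticAt ℝ (fun t : ℝ => ∑ i, n i * ‖t • u - b i‖) t :=
      Finset.analyticAt_fun_sum _ fun i _ => analyticAt_const.mul (h1 i)
    exact ((analyticAt_const.mul analyticAt_id).add h2).sub analyticAt_const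
  have hne : ∃ t, G t ≠ 0 := by
    by_contra! hall
    exact hk (eq_zero_of_forall_mul_add_sum_norm_eq (u := u) (b := b) (n := n) (c := c)
      fun t => by have := hall t; simp only [hG] at this; linarith)
  obtain ⟨t₀, ht₀⟩ := hne
  have hcod := hGa.preimage_zero_mem_codiscrete ht₀
  have hnull : volume {t : ℝ | G t = 0} = 0 := by
    have h3 := ae_restrict_le_codiscreteWithin (μ := volume) MeasurableSet.univ hcod
    rw [Measure.restrict_univ] at h3
    refine measure_mono_null ?_ h3
    intro t ht
    simpa using ht
  refine measure_mono_null ?_ hnull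
  rintro t ⟨ht, hteq⟩
  rw [norm_smul, hu, mul_one, Real.norm_of_nonneg ht.le] at hteq
  simp only [hG, Set.mem_ofPred_eq]
  linarith

variable [FiniteDimensional ℝ E] [MeasurableSpace E] [BorelSpace E] (μ : Measure E)
  [μ.IsAddHaarMeasure]

/-- Fubini in polar coordinates: a measurable set meeting almost no point of each open ray from the
origin is null. -/
lemma measure_eq_zero_of_forall_ray {S : Set E} (hS : MeasurableSet S) (h0 : (0 : E) ∉ S)
    (h : ∀ u : E, ‖u‖ = 1 → volume {t : ℝ | 0 < t ∧ t • u ∈ S} = 0) : μ S = 0 := by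
  have hmp := (μ.measurePreserving_homeomorphUnitSphereProd).symm
    (homeomorphUnitSphereProd E).toMeasurableEquiv
  set T : Set ({0}ᶜ : Set E) := (↑) ⁻¹' S with hT
  have hTm : MeasurableSet T := measurable_subtype_coe hS
  have hST : μ S = (μ.comap ((↑) : ({0}ᶜ : Set E) → E)) T := by
    rw [comap_subtype_coe_apply (measurableSet_singleton _).compl, hT,
      Subtype.image_preimage_coe, Set.inter_eq_right.2]
    rintro x hx rfl
    exact h0 hx
  rw [hST, ← hmp.measure_preimage hTm.nullMeasurableSet,
    Measure.measure_prod_null (hmp.measurable hTm)]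
  refine Eventually.of_forall fun u => ?_
  rw [Pi.zero_apply, Measure.volumeIoiPow]
  refine withDensity_absolutelyContinuous _ _ ?_
  rw [comap_subtype_coe_apply measurableSet_Ioi]
  refine measure_mono_null ?_ (h u (by simp))
  rintro _ ⟨t, ht, rfl⟩
  refine ⟨t.2, ?_⟩
  simpa [hT] using ht

/-- For distinct points `a j` and coefficients that are not all zero, the level sets of
`y ↦ ∑ nⱼ ‖y - aⱼ‖` are null. -/
lemma measure_sum_mul_dist_eq_const {ι : Type*} [Fintype ι] [DecidableEq ι]
    (hE : 2 ≤ Module.finrank ℝ E) {a : ι → E} (ha : Function.Injective a) {n : ι → ℝ} (i : ι)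
    (hi : n i ≠ 0) (c : ℝ) : μ {y | ∑ j, n j * ‖y - a j‖ = c} = 0 := by
  have hspan : ∀ v : E, (Submodule.span ℝ {v}) ≠ ⊤ := by
    intro v hv
    have h1 := finrank_span_le_card (R := ℝ) ({v} : Set E)
    rw [hv, finrank_top] at h1
    simp at h1
    omega
  set b : {j // j ≠ i} → E := fun j => a j - a i with hb
  have hb0 : ∀ j, b j ≠ 0 := fun j => sub_ne_zero.2 (ha.ne j.2)
  -- the lines through `a i` and another of the points
  set N : Set E := ⋃ j, (Submodule.span ℝ {b j} : Set E) with hN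
  have hNm : MeasurableSet N := MeasurableSet.iUnion fun j =>
    (Submodule.closed_of_finiteDimensional _).measurableSet
  have hN0 : μ N = 0 := measure_iUnion_null fun j => μ.addHaar_submodule _ (hspan _)
  have h00 : μ {(0 : E)} = 0 := by
    refine measure_mono_null ?_ (μ.addHaar_submodule _ (hspan 0))
    simp
  set Z : Set E := {y | n i * ‖y‖ + ∑ j : {j // j ≠ i}, n j * ‖y - b j‖ = c} with hZ
  have hZm : MeasurableSet Z := by
    apply IsClosed.measurableSet
    apply isClosed_eq <;> fun_prop
  have hZ0 : μ (Z \ (N ∪ {0})) = 0 := by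
    refine measure_eq_zero_of_forall_ray μ (hZm.diff (hNm.union (measurableSet_singleton _)))
      (by simp) fun u hu => ?_
    by_cases hub : ∀ j, ∀ t : ℝ, t • u ≠ b j
    · refine measure_mono_null ?_ (volume_ray_inter_level_eq_zero (n := fun j : {j // j ≠ i} => n j)
        (c := c) hi hu hub)
      rintro t ⟨ht, htZ, _⟩
      exact ⟨ht, htZ⟩
    · push Not at hub
      obtain ⟨j, t, htj⟩ := hub
      refine measure_mono_null ?_ (measure_empty (μ := volume))
      rintro s ⟨_, -, hs⟩
      apply hs
      left
      have ht : t ≠ 0 := by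
        rintro rfl
        exact hb0 j (by rw [← htj, zero_smul])
      refine Set.mem_iUnion.2 ⟨j, Submodule.mem_span_singleton.2 ⟨s / t, ?_⟩⟩
      rw [← htj, smul_smul, div_mul_cancel₀ _ ht]
  have hZ1 : μ Z = 0 := by
    refine measure_mono_null ?_ (measure_union_null hZ0 (measure_union_null hN0 h00))
    intro y hy
    by_cases hy' : y ∈ N ∪ {0}
    · exact Or.inr hy'
    · exact Or.inl ⟨hy, hy'⟩
  have htrans : {y | ∑ j, n j * ‖y - a j‖ = c} = (fun y => -a i + y) ⁻¹' Z := by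
    ext y
    simp only [hZ, hb, Set.mem_preimage, Set.mem_ofPred_eq]
    have e : ∑ j, n j * ‖y - a j‖ = n i * ‖-a i + y‖ +
        ∑ j : {j // j ≠ i}, n j * ‖-a i + y - (a j - a i)‖ := by
      rw [← Finset.add_sum_erase _ _ (Finset.mem_univ i)]
      congr 1
      · rw [neg_add_eq_sub]
      · rw [← Finset.sum_subtype (Finset.univ.erase i) (by simp)
          (fun j => n j * ‖-a i + y - (a j - a i)‖)]
        refine Finset.sum_congr rfl fun j _ => ?_
        congr 2
        abel
    rw [e]
  rw [htrans, measure_preimage_add]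
  exact hZ1

/-- A measurable set in a product space is null as soon as all its slices in one of the coordinates
are null. -/
lemma measure_pi_eq_zero_of_forall_update {ι : Type*} [Fintype ι] [DecidableEq ι] {X : ι → Type*}
    [∀ i, MeasurableSpace (X i)] (ν : ∀ i, Measure (X i)) [∀ i, SigmaFinite (ν i)]
    {S : Set (∀ i, X i)} (hS : MeasurableSet S) (i : ι)
    (h : ∀ x, ν i {y | Function.update x i y ∈ S} = 0) : Measure.pi ν S = 0 := by
  have h1 : ∀ x : ∀ i, X i, (∫⋯∫⁻_Finset.univ, S.indicator 1 ∂ν) x = Measure.pi ν S := by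
    intro x
    rw [lmarginal_univ, lintegral_indicator_one hS]
  by_cases hne : Nonempty (∀ i, X i)
  · obtain ⟨x⟩ := hne
    rw [← h1 x, lmarginal_erase' _ (measurable_one.indicator hS) (Finset.mem_univ i)]
    have h2 : (fun x => ∫⁻ y, S.indicator (1 : (∀ i, X i) → ℝ≥0∞) (Function.update x i y) ∂ν i) =
        fun _ => 0 := by
      ext x
      have h3 : (fun y => S.indicator (1 : (∀ i, X i) → ℝ≥0∞) (Function.update x i y)) =
          {y | Function.update x i y ∈ S}.indicator 1 := by
        ext y
        simp [Set.indicator]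
      refine (congrArg (lintegral (ν i)) h3).trans ?_
      exact (lintegral_indicator_one (measurable_update x hS)).trans (h x)
    rw [h2]
    simp [lmarginal]
  · have : S = ∅ := Set.eq_empty_of_forall_notMem fun x _ => hne ⟨x⟩
    simp [this]

end SumsOfDistances

namespace PointInteraction

/-! ### The characteristic determinant as an exponential polynomial -/

variable {m : ℕ}

/-- The length `∑ᵢ |Y_{σ(i)} - Yᵢ|` of the closed polygons described by `σ`. -/
noncomputable def permLength (Y : Fin m → Space3) (σ : Equiv.Perm (Fin m)) : ℝ :=
  ∑ i, ‖Y (σ i) - Y i‖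

/-- The constant factor of the entry `(i, j)` of `Γ_Y`, next to a power of `α - iz / 4π` and an
exponential. -/
noncomputable def edgeWeight (Y : Fin m → Space3) (i j : Fin m) : ℂ :=
  if i = j then 1 else -(4 * (Real.pi : ℂ) * (‖Y i - Y j‖ : ℂ))⁻¹

/-- The number of fixed points of `σ`. -/
def fixCount (σ : Equiv.Perm (Fin m)) : ℕ :=
  ∑ i, if σ i = i then 1 else 0

/-- The coefficient of the term of `σ` in the Leibniz expansion of `det Γ_Y`. -/
noncomputable def permCoeff (Y : Fin m → Space3) (σ : Equiv.Perm (Fin m)) : ℂ :=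
  ((Equiv.Perm.sign σ : ℤ) : ℂ) * ∏ i, edgeWeight Y (σ i) i

lemma edgeWeight_symm (Y : Fin m → Space3) (i j : Fin m) :
    edgeWeight Y i j = edgeWeight Y j i := by
  simp only [edgeWeight, norm_sub_rev (Y i) (Y j), eq_comm]

lemma edgeWeight_ne_zero {Y : Fin m → Space3} (hY : Function.Injective Y) (i j : Fin m) :
    edgeWeight Y i j ≠ 0 := by
  unfold edgeWeight
  split_ifs with h
  · exact one_ne_zero
  · have : ‖Y i - Y j‖ ≠ 0 := norm_ne_zero_iff.2 (sub_ne_zero.2 (hY.ne h))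
    simp [hY.eq_iff, sub_eq_zero, h]

lemma permCoeff_ne_zero {Y : Fin m → Space3} (hY : Function.Injective Y)
    (σ : Equiv.Perm (Fin m)) : permCoeff Y σ ≠ 0 := by
  refine mul_ne_zero ?_ (Finset.prod_ne_zero_iff.2 fun i _ => edgeWeight_ne_zero hY _ _)
  exact_mod_cast (Equiv.Perm.sign σ).ne_zero

lemma fixCount_le (σ : Equiv.Perm (Fin m)) : fixCount σ ≤ m := by
  calc fixCount σ ≤ ∑ _i : Fin m, 1 := Finset.sum_le_sum fun i _ => by split_ifs <;> norm_num
    _ = m := by simp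

lemma gammaMatrix_apply {Y : Fin m → Space3} (hY : Function.Injective Y) (α z : ℂ) (i j : Fin m) :
    gammaMatrix α Y z i j = edgeWeight Y i j *
      (α - Complex.I * z / (4 * (Real.pi : ℂ))) ^ (if i = j then 1 else 0) *
      Complex.exp (Complex.I * z * (‖Y i - Y j‖ : ℝ)) := by
  by_cases h : i = j
  · simp [gammaMatrix, edgeWeight, greenTilde, h]
  · have h1 : Y i - Y j ≠ 0 := sub_ne_zero.2 (hY.ne h)
    simp only [gammaMatrix, edgeWeight, greenTilde, h, h1, Matrix.of_apply, if_false, zero_sub,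
      pow_zero, mul_one]
    ring

lemma charDet_eq_sum {Y : Fin m → Space3} (hY : Function.Injective Y) (α z : ℂ) :
    charDet α Y z = ∑ σ, permCoeff Y σ *
      (α - Complex.I * z / (4 * (Real.pi : ℂ))) ^ fixCount σ *
      Complex.exp (Complex.I * z * permLength Y σ) := by
  rw [charDet, Matrix.det_apply']
  refine Finset.sum_congr rfl fun σ _ => ?_
  simp only [gammaMatrix_apply hY, Finset.prod_mul_distrib, Finset.prod_pow_eq_pow_sum,
    ← Complex.exp_sum, ← Finset.mul_sum]
  rw [permCoeff, fixCount, permLength]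
  push_cast
  ring

lemma permLength_nonneg (Y : Fin m → Space3) (σ : Equiv.Perm (Fin m)) : 0 ≤ permLength Y σ :=
  Finset.sum_nonneg fun _ _ => norm_nonneg _

lemma permLength_eq_zero_iff {Y : Fin m → Space3} (hY : Function.Injective Y)
    (σ : Equiv.Perm (Fin m)) : permLength Y σ = 0 ↔ σ = 1 := by
  rw [permLength, Finset.sum_eq_zero_iff_of_nonneg fun _ _ => norm_nonneg _]
  simp only [Finset.mem_univ, true_imp_iff, norm_eq_zero, sub_eq_zero, hY.eq_iff]
  exact ⟨fun h => Equiv.ext h, fun h i => by simp [h]⟩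

lemma size_eq_sup' (Y : Fin m → Space3) :
    size Y = Finset.univ.sup' Finset.univ_nonempty (permLength Y) := by
  rw [size]
  congr
  ext σ
  exact Finset.sum_congr rfl fun i _ => norm_sub_rev _ _

lemma permLength_le_size (Y : Fin m → Space3) (σ : Equiv.Perm (Fin m)) :
    permLength Y σ ≤ size Y := by
  rw [size_eq_sup']
  exact Finset.le_sup' _ (Finset.mem_univ σ)

lemma exists_permLength_eq_size (Y : Fin m → Space3) : ∃ σ, permLength Y σ = size Y := by
  rw [size_eq_sup']
  obtain ⟨σ, _, h⟩ := Finset.exists_mem_eq_sup' Finset.univ_nonempty (permLength Y)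
  exact ⟨σ, h.symm⟩

/-- If permutations of equal length have the same undirected edges, then the terms of maximal
frequency in `det Γ_Y` are all equal, so they cannot cancel. -/
theorem hasTotalAsymptoticDensity_of_generic {Y : Fin m → Space3} (hY : Function.Injective Y)
    (hgen : ∀ σ τ : Equiv.Perm (Fin m), permLength Y σ = permLength Y τ →
      ∀ i j, i ≠ j → edgeCount σ i j = edgeCount τ i j) (α : ℂ) :
    HasTotalAsymptoticDensity α Y (size Y / Real.pi) := by
  have hterm : ∀ σ τ : Equiv.Perm (Fin m), permLength Y σ = permLength Y τ →
      permCoeff Y σ = permCoeff Y τ ∧ fixCount σ = fixCount τ := by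
    intro σ τ h
    have hcount := edgeCount_eq_of_off_diag (hgen σ τ h)
    refine ⟨?_, ?_⟩
    · rw [permCoeff, permCoeff, sign_eq_of_edgeCount_eq hcount,
        prod_eq_of_edgeCount_eq (edgeWeight_symm Y) hcount]
    · exact Finset.sum_congr rfl fun i _ =>
        if_congr (apply_eq_self_iff_of_edgeCount_eq hcount i) rfl rfl
  have hsize : 0 ≤ size Y := (permLength_nonneg Y 1).trans (permLength_le_size Y 1)
  refine ⟨div_nonneg hsize Real.pi_pos.le, ?_⟩
  exact expPoly_tendsto_zeroCount_div (fun z => charDet_eq_sum hY α z) fixCount_le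
    (permCoeff_ne_zero hY) (fun σ => ⟨permLength_nonneg Y σ, permLength_le_size Y σ⟩)
    ⟨1, (permLength_eq_zero_iff hY 1).2 rfl⟩ (exists_permLength_eq_size Y)
    (fun σ τ hσ hτ => hterm σ τ (hσ.trans hτ.symm))
    (fun σ τ hσ hτ => hterm σ τ (hσ.trans hτ.symm))

/-! ### Genericity of random configurations -/

lemma two_mul_permLength (Y : Fin m → Space3) (σ : Equiv.Perm (Fin m)) :
    2 * permLength Y σ = ∑ i, ∑ j, (edgeCount σ i j : ℝ) * ‖Y i - Y j‖ := by
  have h1 : ∑ i, ∑ j, (if σ i = j then (1 : ℝ) else 0) * ‖Y i - Y j‖ = permLength Y σ := by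
    simp [permLength, norm_sub_rev]
  have h2 : ∑ i, ∑ j, (if σ j = i then (1 : ℝ) else 0) * ‖Y i - Y j‖ = permLength Y σ := by
    rw [Finset.sum_comm]
    simp [permLength]
  simp only [edgeCount, Nat.cast_add, Nat.cast_ite, Nat.cast_one, Nat.cast_zero, add_mul,
    Finset.sum_add_distrib]
  rw [h1, h2]
  ring

lemma edgeCount_symm (σ : Equiv.Perm (Fin m)) (i j : Fin m) :
    edgeCount σ i j = edgeCount σ j i := add_comm _ _

lemma sum_sum_eq_of_symm {ι : Type*} [Fintype ι] [DecidableEq ι] {F : ι → ι → ℝ}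
    (hF : ∀ k l, F k l = F l k) (i : ι) :
    ∑ k, ∑ l, F k l = F i i + 2 * ∑ l : {l // l ≠ i}, F i l +
      ∑ k : {k // k ≠ i}, ∑ l : {l // l ≠ i}, F k l := by
  have hsub : ∀ G : ι → ℝ, ∑ l, G l = G i + ∑ l : {l // l ≠ i}, G l := by
    intro G
    rw [← Finset.add_sum_erase _ _ (Finset.mem_univ i),
      ← Finset.sum_subtype (Finset.univ.erase i) (by simp) G]
  rw [hsub]
  simp only [hsub (F _), Finset.sum_add_distrib]
  simp only [hF _ i]
  ring

lemma measurableSet_injective :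
    MeasurableSet {Y : Fin m → Space3 | Function.Injective Y} := by
  have : {Y : Fin m → Space3 | Function.Injective Y} =
      ⋂ i, ⋂ j, {Y | Y i = Y j → i = j} := by
    ext Y
    simp [Function.Injective]
  rw [this]
  refine MeasurableSet.iInter fun i => MeasurableSet.iInter fun j => ?_
  by_cases hij : i = j
  · simp [hij]
  · simp only [hij, imp_false]
    exact (measurableSet_eq_fun (measurable_pi_apply i) (measurable_pi_apply j)).compl

lemma measurableSet_permLength_eq (σ τ : Equiv.Perm (Fin m)) :
    MeasurableSet {Y : Fin m → Space3 | permLength Y σ = permLength Y τ} := by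
  apply IsClosed.measurableSet
  unfold permLength
  apply isClosed_eq <;> fun_prop

variable {ν : Fin m → Measure Space3} [∀ i, IsProbabilityMeasure (ν i)]

lemma ae_injective_of_absolutelyContinuous (hν : ∀ i, ν i ≪ volume) :
    ∀ᵐ Y ∂Measure.pi ν, Function.Injective Y := by
  have h : ∀ i j, i ≠ j → ∀ᵐ Y ∂Measure.pi ν, Y i ≠ Y j := by
    intro i j hij
    rw [ae_iff]
    simp only [not_not]
    refine measure_pi_eq_zero_of_forall_update ν
      (measurableSet_eq_fun (measurable_pi_apply i) (measurable_pi_apply j)) i fun x => ?_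
    simp only [Set.mem_ofPred_eq, Function.update_self, Function.update_of_ne hij.symm]
    exact hν i (measure_singleton (x j))
  have h' : ∀ᵐ Y ∂Measure.pi ν, ∀ i j, i ≠ j → Y i ≠ Y j := by
    simp only [ae_all_iff]
    exact h
  filter_upwards [h'] with Y hY i j hij
  by_contra hne
  exact hY i j hne hij

/-- Moving the single point `Yᵢ`, the lengths of two permutations with different edges at `i` agree
only on a null set. -/
lemma measure_permLength_eq_inter_injective (hν : ∀ i, ν i ≪ volume) {σ τ : Equiv.Perm (Fin m)}
    {i j : Fin m} (hij : i ≠ j) (hne : edgeCount σ i j ≠ edgeCount τ i j) :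
    Measure.pi ν ({Y | permLength Y σ = permLength Y τ} ∩ {Y | Function.Injective Y}) = 0 := by
  refine measure_pi_eq_zero_of_forall_update ν
    ((measurableSet_permLength_eq σ τ).inter measurableSet_injective) i fun x => hν i ?_
  by_cases hx : Function.Injective fun l : {l // l ≠ i} => x l
  · set n : Fin m → Fin m → ℝ := fun k l => (edgeCount σ k l : ℝ) - edgeCount τ k l with hn
    set c : ℝ := ∑ k : {k // k ≠ i}, ∑ l : {l // l ≠ i}, n k l * ‖x k - x l‖ with hc
    have hdim : 2 ≤ Module.finrank ℝ Space3 := by simp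
    refine measure_mono_null ?_ (measure_sum_mul_dist_eq_const volume hdim hx
      (n := fun l : {l // l ≠ i} => n i l) ⟨j, hij.symm⟩ ?_ (-c / 2))
    · rintro y ⟨hy, -⟩
      have hy' : permLength (Function.update x i y) σ = permLength (Function.update x i y) τ := hy
      set Y := Function.update x i y with hY
      have h1 : ∑ k, ∑ l, n k l * ‖Y k - Y l‖ = 0 := by
        simp only [hn, sub_mul, Finset.sum_sub_distrib]
        rw [← two_mul_permLength, ← two_mul_permLength, hy', sub_self]
      rw [sum_sum_eq_of_symm (fun k l => by
        simp only [hn, edgeCount_symm _ k l, norm_sub_rev (Y k)]) i] at h1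
      have hYi : Y i = y := by simp [hY]
      have hYl : ∀ l : {l // l ≠ i}, Y l = x l := fun l => by simp [hY, l.2]
      simp only [hYi, hYl, sub_self, norm_zero, mul_zero, zero_add] at h1
      rw [Set.mem_ofPred_eq]
      linarith
    · simp only [hn]
      exact sub_ne_zero.2 (by exact_mod_cast hne)
  · refine measure_mono_null ?_ (measure_empty (μ := volume))
    rintro y ⟨-, hy⟩
    have hy' : Function.Injective (Function.update x i y) := hy
    refine hx fun k l hkl => Subtype.ext (hy' ?_)
    simpa [k.2, l.2] using hkl

/-- For independent points with absolutely continuous laws, permutations of equal length have the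
same undirected edges, almost surely. -/
lemma ae_edgeCount_eq_of_permLength_eq (hν : ∀ i, ν i ≪ volume) :
    ∀ᵐ Y ∂Measure.pi ν, ∀ σ τ : Equiv.Perm (Fin m), permLength Y σ = permLength Y τ →
      ∀ i j, i ≠ j → edgeCount σ i j = edgeCount τ i j := by
  have h : ∀ σ τ : Equiv.Perm (Fin m), ∀ i j, i ≠ j → edgeCount σ i j ≠ edgeCount τ i j →
      ∀ᵐ Y ∂Measure.pi ν, permLength Y σ ≠ permLength Y τ := by
    intro σ τ i j hij hne
    have h1 : ∀ᵐ Y ∂Measure.pi ν,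
        Y ∉ {Y | permLength Y σ = permLength Y τ} ∩ {Y | Function.Injective Y} :=
      measure_eq_zero_iff_ae_notMem.1 (measure_permLength_eq_inter_injective hν hij hne)
    filter_upwards [h1, ae_injective_of_absolutelyContinuous hν] with Y hY1 hY2 hY3
    exact hY1 ⟨hY3, hY2⟩
  have h' : ∀ᵐ Y ∂Measure.pi ν, ∀ σ τ : Equiv.Perm (Fin m), ∀ i j, i ≠ j →
      edgeCount σ i j ≠ edgeCount τ i j → permLength Y σ ≠ permLength Y τ := by
    simp only [ae_all_iff]
    exact h
  filter_upwards [h'] with Y hY σ τ hlen i j hij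
  by_contra hne
  exact hY σ τ i j hij hne hlen

end PointInteraction

/-- Almost surely the centres are distinct (so that `H_Υ` is defined) and `Ad(H_Υ) = V(Υ)/π`. -/
theorem theorem3p1 {Ω : Type*} [MeasurableSpace Ω] (P : MeasureTheory.Measure Ω)
    [MeasureTheory.IsProbabilityMeasure P] (α : ℂ) (m : ℕ) (r : ℝ) (hr : 0 < r)
    (Υ : Fin m → Ω → Space3) (hΥ : PointInteraction.IsUniformBinomialProcess P m r Υ) :
    ∀ᵐ ω ∂P, Function.Injective (fun j => Υ j ω) ∧
      PointInteraction.HasTotalAsymptoticDensity α (fun j => Υ j ω)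
        (PointInteraction.size (fun j => Υ j ω) / Real.pi) := by
  have hprob : ∀ j, IsProbabilityMeasure (P.map (Υ j)) := fun j =>
    Measure.isProbabilityMeasure_map (hΥ.aemeasurable j)
  have hac : ∀ j, P.map (Υ j) ≪ volume := fun j => (hΥ.uniform j).absolutelyContinuous
  have hlaw := (iIndepFun_iff_map_fun_eq_pi_map hΥ.aemeasurable).1 hΥ.indep
  have hmeas : AEMeasurable (fun ω j => Υ j ω) P := aemeasurable_pi_iff.2 hΥ.aemeasurable
  refine ae_of_ae_map hmeas (p := fun Y => Function.Injective Y ∧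
    PointInteraction.HasTotalAsymptoticDensity α Y (PointInteraction.size Y / Real.pi)) ?_
  rw [hlaw]
  filter_upwards [PointInteraction.ae_injective_of_absolutelyContinuous hac,
    PointInteraction.ae_edgeCount_eq_of_permLength_eq hac] with Y hY hgen
  exact ⟨hY, PointInteraction.hasTotalAsymptoticDensity_of_generic hY hgen α⟩
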